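/- Let $R$ be a commutative ring and let $(A,C,\psi)$ be a right-right entwining structure over $R$: $A$ is an associative unital $R$-algebra, $(C,\Delta,\varepsilon)$ is an $R$-coalgebra, and $\psi:C\otimes_R A\to A\otimes_R C$, $c\otimes a\mapsto\sum a_\psi\otimes c^\psi$, is an $R$-linear map such that for all $a,\tilde a\in A$ and $c\in C$ $$\sum (a\tilde a)_\psi\otimes c^\psi=\sum a_\psi\tilde a_\Psi\otimes c^{\psi\Psi},\qquad \sum (1_A)_\psi\otimes c^\psi=1_A\otimes c,$$ $$\sum a_\psi\otimes\Delta(c^\psi)=\sum a_{\psi\Psi}\otimes c_1^{\Psi}\otimes c_2^{\psi},\qquad \sum a_\psi\,\varepsilon(c^\psi)=\varepsilon(c)\,a.$$ An *entwined module* is a right $A$-module $M$ with a (coassociative and counital) right $C$-comodule structure $\varrho_M(m)=\sum m_{<0>}\otimes m_{<1>}\in M\otimes_R C$ such that $\varrho_M(ma)=\sum m_{<0>}a_\psi\otimes m_{<1>}^\psi$ for all $m\in M$, $a\in A$; these form the category $\mathcal M_A^C(\psi)$. Assume that $A$, as a right module over itself, is equipped with a coaction $\varrho_A(a)=\sum a_{<0>}\otimes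 a_{<1>}$ making it an entwined module, and write $\sum 1_{<0>}\otimes 1_{<1>}=\varrho_A(1_A)$. For $M\in\mathcal M_A^C(\psi)$ put $$M^{co\,\mathcal C}=\{m\in M:\ \varrho_M(m)=\sum m1_{<0>}\otimes 1_{<1>}\},\qquad B=A^{co\,\mathcal C};$$ $B$ is a subalgebra of $A$ and $M^{co\,\mathcal C}$ is a right $B$-module. For a right $B$-module $N$, $N\otimes_B A$ is an entwined module with action $(n\otimes a)a'=n\otimes aa'$ and coaction $n\otimes a\mapsto\sum (n\otimes a_{<0>})\otimes a_{<1>}$. Consider $$\Psi_M:M^{co\,\mathcal C}\otimes_B A\to M,\ m\otimes a\mapsto ma,\qquad \Phi_N:N\to (N\otimes_B A)^{co\,\mathcal C},\ n\mapsto n\otimes 1_A.$$ * $\mathcal M_A^C(\psi)$ satisfies the *weak structure theorem* if $\Psi_M$ is an isomorphism for every $M\in\mathcal M_A^C(\psi)$, and the *strong structure theorem* if moreover $\Phi_N$ is an isomorphism for every right $B$-module $N$. * $A/B$ is *$\mathcal C$-Galois* (for the coring $\mathcal C=A\otimes_R C$) if $\beta:A\otimes_B A\to A\otimes_R C$, $\tilde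 a\otimes a\mapsto\sum\tilde a a_{<0>}\otimes a_{<1>}$, is bijective. * $A/B$ is *cleft* if there is a right $C$-colinear map $\lambda:C\to A$ that is invertible in $\mathrm{Hom}_R(C,A)$ for the convolution product $(f\star g)(c)=\sum f(c_1)g(c_2)$ with unit $c\mapsto\varepsilon(c)1_A$. * $A$ has the *right normal basis property* if there is a left $B$-linear and right $C$-colinear isomorphism $A\simeq B\otimes_R C$, where $C$ coacts on $B\otimes_R C$ by $\mathrm{id}_B\otimes\Delta$. * $\#_\psi^{op}(C,A)$ is the ring $\mathrm{Hom}_R(C,A)$ with multiplication $(f\cdot g)(c)=\sum f(c_2)_\psi\, g(c_1^\psi)$ and unit $c\mapsto\varepsilon(c)1_A$, and $\Lambda:\#_\psi^{op}(C,A)\to \mathrm{End}({}_BA)^{op}$ is the ring morphism $g\mapsto[a\mapsto\sum a_{<0>}g(a_{<1>})]$. **Theorem.** The following statements are equivalent: 1. $A/B$ is cleft; 2. $\mathcal M_A^C(\psi)$ satisfies the weak structure theorem and $A$ has the right normal basis property; 3. $A/B$ is $\mathcal C$-Galois and $A$ has the right normal basis property; 4. $\Lambda$ is a ring isomorphism and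 $A$ has the right normal basis property. If moreover ${}_RC$ is faithfully flat, then (1)-(4) are also equivalent to 5. $\mathcal M_A^C(\psi)$ satisfies the strong structure theorem and $A$ has the right normal basis property. -/

import Mathlib

open scoped TensorProduct
open MulOpposite

universe uR uA uC w

noncomputable section

/-! Right `A`-modules are `Aᵐᵒᵖ`-modules (`m · a` is `op a • m`). -/

/-! ### Tensor products over a noncommutative ring -/

/-- The balancing relations `(n · s) ⊗ l - n ⊗ (s · l)`. -/
def balancedRel (R S N L : Type*) [CommRing R] [Ring S] [AddCommGroup N] [Module R N]
    [Module Sᵐᵒᵖ N] [AddCommGroup L] [Module R L] [Module S L] : Submodule R (N ⊗[R] L) :=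
  Submodule.span R {t | ∃ (n : N) (s : S) (l : L), t = (op s • n) ⊗ₜ[R] l - n ⊗ₜ[R] (s • l)}

/-- The tensor product `N ⊗_S L` of a right module `N` and a left module `L` over an
`R`-algebra `S`, as the quotient of `N ⊗_R L` by the balancing relations. -/
def BalancedTensor (R S N L : Type*) [CommRing R] [Ring S] [AddCommGroup N] [Module R N]
    [Module Sᵐᵒᵖ N] [AddCommGroup L] [Module R L] [Module S L] : Type _ :=
  (N ⊗[R] L) ⧸ balancedRel R S N L

namespace BalancedTensor

variable {R S N L P : Type*} [CommRing R] [Ring S] [AddCommGroup N] [Module R N]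
  [Module Sᵐᵒᵖ N] [AddCommGroup L] [Module R L] [Module S L] [AddCommGroup P] [Module R P]

instance : AddCommGroup (BalancedTensor R S N L) :=
  inferInstanceAs (AddCommGroup ((N ⊗[R] L) ⧸ balancedRel R S N L))

instance : Module R (BalancedTensor R S N L) :=
  inferInstanceAs (Module R ((N ⊗[R] L) ⧸ balancedRel R S N L))

variable (R S N L) in
/-- The projection `N ⊗_R L → N ⊗_S L`. -/
def proj : N ⊗[R] L →ₗ[R] BalancedTensor R S N L := (balancedRel R S N L).mkQ

variable (R S) in
/-- The pure tensor `n ⊗_S l`. -/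
def tmul (n : N) (l : L) : BalancedTensor R S N L :=
  proj R S N L (n ⊗ₜ[R] l)

theorem smul_tmul (n : N) (s : S) (l : L) :
    tmul R S (op s • n) l = tmul R S n (s • l) := by
  rw [tmul, tmul, ← sub_eq_zero, ← map_sub]
  exact (Submodule.Quotient.mk_eq_zero _).2 (Submodule.subset_span ⟨n, s, l, rfl⟩)

/-- Descent of a balanced bilinear map to `N ⊗_S L`. -/
def lift (f : N →ₗ[R] L →ₗ[R] P) (hf : ∀ n (s : S) l, f (op s • n) l = f n (s • l)) :
    BalancedTensor R S N L →ₗ[R] P :=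
  (balancedRel R S N L).liftQ (TensorProduct.lift f) <| by
    rw [balancedRel, Submodule.span_le]
    rintro _ ⟨n, s, l, rfl⟩
    simp [hf]

@[simp] theorem lift_tmul (f : N →ₗ[R] L →ₗ[R] P)
    (hf : ∀ n (s : S) l, f (op s • n) l = f n (s • l)) (n : N) (l : L) :
    lift f hf (tmul R S n l) = f n l := by
  exact TensorProduct.lift.tmul n l

theorem hom_ext {f g : BalancedTensor R S N L →ₗ[R] P}
    (h : ∀ n l, f (tmul R S n l) = g (tmul R S n l)) : f = g := by
  apply Submodule.linearMap_qext
  apply TensorProduct.ext'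
  exact h

variable (R S) in
theorem tmul_add (n : N) (l l' : L) :
    tmul R S n (l + l') = tmul R S n l + tmul R S n l' := by
  simp [tmul, TensorProduct.tmul_add]

variable (R S) in
theorem tmul_zero (n : N) : tmul R S n (0 : L) = 0 := by
  simp [tmul]

variable (R S) in
theorem tmul_smul (r : R) (n : N) (l : L) : tmul R S n (r • l) = r • tmul R S n l := by
  simp [tmul]

variable (R S N L) in
/-- The bilinear map `(n, l) ↦ n ⊗_S l`. -/
def mk : N →ₗ[R] L →ₗ[R] BalancedTensor R S N L :=
  (TensorProduct.mk R N L).compr₂ (proj R S N L)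

@[simp] theorem mk_apply (n : N) (l : L) : mk R S N L n l = tmul R S n l := rfl

section RightModule

variable {A : Type*} [Ring A] [Algebra R A] [Module Aᵐᵒᵖ L] [IsScalarTower R Aᵐᵒᵖ L]
  [SMulCommClass S Aᵐᵒᵖ L]

/-- For `L` an `(S, A)`-bimodule, the endomorphism `n ⊗ l ↦ n ⊗ (l · a)` of `N ⊗_S L`. -/
def rightSMul (a : Aᵐᵒᵖ) : BalancedTensor R S N L →ₗ[R] BalancedTensor R S N L :=
  lift ((mk R S N L).compl₂ (Algebra.lsmul R R L a)) <| by
    intro n s l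
    simp [smul_tmul, smul_comm]

@[simp] theorem rightSMul_tmul (a : Aᵐᵒᵖ) (n : N) (l : L) :
    rightSMul a (tmul R S n l) = tmul R S n (a • l) :=
  lift_tmul _ _ n l

/-- For `L` an `(S, A)`-bimodule, `N ⊗_S L` is a right `A`-module through `L`. -/
instance : Module Aᵐᵒᵖ (BalancedTensor R S N L) :=
  Module.compHom _
    ({ toFun := rightSMul
       map_one' := hom_ext fun n l => by simp
       map_mul' := fun a b => hom_ext fun n l => by simp [mul_smul]
       map_zero' := hom_ext fun n l => by simp [tmul_zero]
       map_add' := fun a b => hom_ext fun n l => by simp [add_smul, tmul_add] } :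
      Aᵐᵒᵖ →+* Module.End R (BalancedTensor R S N L))

@[simp] theorem op_smul_tmul (a : Aᵐᵒᵖ) (n : N) (l : L) :
    a • tmul R S n l = tmul R S n (a • l) := rightSMul_tmul a n l

instance : IsScalarTower R Aᵐᵒᵖ (BalancedTensor R S N L) where
  smul_assoc r a t := by
    have h : rightSMul (r • a) = r • (rightSMul a :
        BalancedTensor R S N L →ₗ[R] BalancedTensor R S N L) :=
      hom_ext fun n l => by simp [tmul_smul]
    exact LinearMap.congr_fun h t

end RightModule

end BalancedTensor

/-! ### Entwining structures and entwined modules -/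

section Act

variable {R : Type uR} {A : Type uA} {C : Type uC} [CommRing R] [Ring A] [Algebra R A]
  [AddCommGroup C] [Module R C]

/-- The action `(m, a) ↦ m · a` of a right `A`-module `M`. -/
def actR (R : Type uR) (A : Type uA) [CommRing R] [Ring A] [Algebra R A] (M : Type*)
    [AddCommGroup M] [Module R M] [Module Aᵐᵒᵖ M] [IsScalarTower R Aᵐᵒᵖ M] :
    M →ₗ[R] A →ₗ[R] M :=
  LinearMap.mk₂ R (fun m a => op a • m) (fun _ _ _ => smul_add _ _ _)
    (fun _ _ _ => smul_comm _ _ _) (fun _ _ _ => by simp [add_smul])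
    (fun _ _ _ => by simp)

@[simp] theorem actR_apply {M : Type*} [AddCommGroup M] [Module R M] [Module Aᵐᵒᵖ M]
    [IsScalarTower R Aᵐᵒᵖ M] (m : M) (a : A) : actR R A M m a = op a • m := rfl

/-- For a right `A`-module `M`, the map `m ⊗ (a ⊗ c) ↦ (m · a) ⊗ c`. -/
def actTensor (R : Type uR) (A : Type uA) (C : Type uC) [CommRing R] [Ring A] [Algebra R A]
    [AddCommGroup C] [Module R C] (M : Type*)
    [AddCommGroup M] [Module R M] [Module Aᵐᵒᵖ M] [IsScalarTower R Aᵐᵒᵖ M] :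
    M ⊗[R] (A ⊗[R] C) →ₗ[R] M ⊗[R] C :=
  (TensorProduct.lift (actR R A M)).rTensor C ∘ₗ (TensorProduct.assoc R M A C).symm.toLinearMap

/-- For `ψ : c ⊗ a ↦ ∑ a_ψ ⊗ c^ψ`, the map `m ⊗ c ↦ ∑ m · a_ψ ⊗ c^ψ` of `M ⊗ C`.
For `M = A` it is the right multiplication by `a` on `A ⊗ C`. -/
def rightMul (ψ : C ⊗[R] A →ₗ[R] A ⊗[R] C) (M : Type*)
    [AddCommGroup M] [Module R M] [Module Aᵐᵒᵖ M] [IsScalarTower R Aᵐᵒᵖ M] (a : A) :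
    M ⊗[R] C →ₗ[R] M ⊗[R] C :=
  actTensor R A C M ∘ₗ LinearMap.lTensor M (ψ ∘ₗ (TensorProduct.mk R C A).flip a)

end Act

/-- A right-right entwining structure `(A, C, ψ)` over `R`, with
`ψ : c ⊗ a ↦ ∑ a_ψ ⊗ c^ψ`. -/
structure Entwining (R : Type uR) (A : Type uA) (C : Type uC) [CommRing R] [Ring A]
    [Algebra R A] [AddCommGroup C] [Module R C] [Coalgebra R C] where
  psi : C ⊗[R] A →ₗ[R] A ⊗[R] C
  /-- `∑ (a b)_ψ ⊗ c^ψ = ∑ a_ψ b_Ψ ⊗ c^{ψΨ}` -/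
  psi_mul : ∀ (c : C) (a b : A), psi (c ⊗ₜ (a * b)) = rightMul psi A b (psi (c ⊗ₜ a))
  /-- `∑ 1_ψ ⊗ c^ψ = 1 ⊗ c` -/
  psi_one : ∀ c : C, psi (c ⊗ₜ 1) = 1 ⊗ₜ c
  /-- `∑ a_ψ ⊗ Δ(c^ψ) = ∑ a_{ψΨ} ⊗ c₁^Ψ ⊗ c₂^ψ` -/
  psi_comul : ∀ (c : C) (a : A),
    LinearMap.lTensor A Coalgebra.comul (psi (c ⊗ₜ a)) =
      TensorProduct.assoc R A C C (psi.rTensor C ((TensorProduct.assoc R C A C).symm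
        (psi.lTensor C (TensorProduct.assoc R C C A (Coalgebra.comul (R := R) c ⊗ₜ a)))))
  /-- `∑ a_ψ ε(c^ψ) = ε(c) a` -/
  psi_counit : ∀ (c : C) (a : A),
    TensorProduct.rid R A (LinearMap.lTensor A Coalgebra.counit (psi (c ⊗ₜ a))) =
      Coalgebra.counit (R := R) c • a

/-- An entwined module: a right `C`-comodule structure on the right `A`-module `M` with
`ϱ(m · a) = ∑ m₀ · a_ψ ⊗ m₁^ψ`. -/
structure EntwinedModule {R : Type uR} {A : Type uA} {C : Type uC} [CommRing R] [Ring A]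
    [Algebra R A] [AddCommGroup C] [Module R C] [Coalgebra R C] (E : Entwining R A C)
    (M : Type*) [AddCommGroup M] [Module R M] [Module Aᵐᵒᵖ M] [IsScalarTower R Aᵐᵒᵖ M] where
  coact : M →ₗ[R] M ⊗[R] C
  coassoc : ∀ m : M, TensorProduct.assoc R M C C (coact.rTensor C (coact m)) =
    LinearMap.lTensor M Coalgebra.comul (coact m)
  counit : ∀ m : M, TensorProduct.rid R M (LinearMap.lTensor M Coalgebra.counit (coact m)) = m
  coact_smul : ∀ (m : M) (a : A), coact (op a • m) = rightMul E.psi M a (coact m)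

/-- `f : M → N` is a morphism of right `C`-comodules. -/
def IsColinear {R C M N : Type*} [CommRing R] [AddCommGroup C] [Module R C]
    [AddCommGroup M] [Module R M] [AddCommGroup N] [Module R N]
    (ρM : M →ₗ[R] M ⊗[R] C) (ρN : N →ₗ[R] N ⊗[R] C) (f : M →ₗ[R] N) : Prop :=
  ∀ m, ρN (f m) = f.rTensor C (ρM m)

namespace Entwining

variable {R : Type uR} {A : Type uA} {C : Type uC} [CommRing R] [Ring A]
    [Algebra R A] [AddCommGroup C] [Module R C]

@[simp] theorem actTensor_tmul {M : Type*} [AddCommGroup M] [Module R M] [Module Aᵐᵒᵖ M]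
    [IsScalarTower R Aᵐᵒᵖ M] (m : M) (t : A ⊗[R] C) :
    actTensor R A C M (m ⊗ₜ t) = (actR R A M m).rTensor C t := by
  induction t with
  | zero => simp
  | tmul a c => simp [actTensor]
  | add x y hx hy => simp only [TensorProduct.tmul_add, map_add, hx, hy]

@[simp] theorem rightMul_tmul (ψ : C ⊗[R] A →ₗ[R] A ⊗[R] C) {M : Type*} [AddCommGroup M]
    [Module R M] [Module Aᵐᵒᵖ M] [IsScalarTower R Aᵐᵒᵖ M] (a : A) (m : M) (c : C) :
    rightMul ψ M a (m ⊗ₜ c) = (actR R A M m).rTensor C (ψ (c ⊗ₜ a)) := by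
  simp [rightMul]

/-- Naturality of `rightMul` in the right `A`-module. -/
theorem rightMul_rTensor (ψ : C ⊗[R] A →ₗ[R] A ⊗[R] C) {M N : Type*} [AddCommGroup M]
    [Module R M] [Module Aᵐᵒᵖ M] [IsScalarTower R Aᵐᵒᵖ M] [AddCommGroup N]
    [Module R N] [Module Aᵐᵒᵖ N] [IsScalarTower R Aᵐᵒᵖ N] (f : M →ₗ[R] N)
    (hf : ∀ m (a : A), f (op a • m) = op a • f m) (a : A) (t : M ⊗[R] C) :
    rightMul ψ N a (f.rTensor C t) = f.rTensor C (rightMul ψ M a t) := by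
  induction t with
  | zero => simp
  | tmul m c =>
    have h : actR R A N (f m) = f ∘ₗ actR R A M m := LinearMap.ext fun a => (hf m a).symm
    rw [LinearMap.rTensor_tmul, rightMul_tmul, rightMul_tmul, h, LinearMap.rTensor_comp,
      LinearMap.comp_apply]
  | add x y hx hy => simp only [map_add, hx, hy]

end Entwining

namespace EntwinedModule

variable {R : Type uR} {A : Type uA} {C : Type uC} [CommRing R] [Ring A]
    [Algebra R A] [AddCommGroup C] [Module R C] [Coalgebra R C] {E : Entwining R A C}

section Coinv

variable {M : Type*} [AddCommGroup M] [Module R M] [Module Aᵐᵒᵖ M] [IsScalarTower R Aᵐᵒᵖ M]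

/-- The element `∑ 1₀ ⊗ 1₁` of `A ⊗ C`. -/
def grouplike (ρA : EntwinedModule E A) : A ⊗[R] C := ρA.coact 1

/-- The coinvariants `M^{co 𝒞} = {m | ∑ m₀ ⊗ m₁ = ∑ m · 1₀ ⊗ 1₁}`. -/
def coinv (ρA : EntwinedModule E A) (ρM : EntwinedModule E M) : Submodule R M :=
  LinearMap.eqLocus ρM.coact
    (actTensor R A C M ∘ₗ (TensorProduct.mk R M (A ⊗[R] C)).flip ρA.grouplike)

theorem mem_coinv (ρA : EntwinedModule E A) (ρM : EntwinedModule E M) (m : M) :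
    m ∈ coinv ρA ρM ↔ ρM.coact m = (actR R A M m).rTensor C ρA.grouplike := by
  simp [coinv, LinearMap.mem_eqLocus]

theorem coact_eq (ρA : EntwinedModule E A) (a : A) :
    ρA.coact a = rightMul E.psi A a ρA.grouplike := by
  simpa [grouplike] using ρA.coact_smul 1 a

theorem coact_smul_coinv (ρA : EntwinedModule E A) (ρM : EntwinedModule E M) {m : M}
    (hm : m ∈ coinv ρA ρM) (a : A) :
    ρM.coact (op a • m) = (actR R A M m).rTensor C (ρA.coact a) := by
  rw [ρM.coact_smul, (mem_coinv ρA ρM m).1 hm, coact_eq,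
    Entwining.rightMul_rTensor _ (actR R A M m) (fun x a => by simp [mul_smul])]

theorem smul_mem_coinv (ρA : EntwinedModule E A) (ρM : EntwinedModule E M) {m : M}
    (hm : m ∈ coinv ρA ρM) {b : A} (hb : b ∈ coinv ρA ρA) : op b • m ∈ coinv ρA ρM := by
  rw [mem_coinv, coact_smul_coinv ρA ρM hm, (mem_coinv ρA ρA b).1 hb,
    ← LinearMap.comp_apply, ← LinearMap.rTensor_comp]
  congr 2
  ext x
  simp [mul_smul]

theorem algebraMap_mem_coinv (ρA : EntwinedModule E A) (r : R) :
    algebraMap R A r ∈ coinv ρA ρA := by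
  rw [mem_coinv, Algebra.algebraMap_eq_smul_one, map_smul, map_smul, LinearMap.rTensor_smul]
  have : actR R A A 1 = LinearMap.id := by ext; simp
  simp [this, grouplike]

/-- The subalgebra `B = A^{co 𝒞}` of `A`. -/
def base (ρA : EntwinedModule E A) : Subalgebra R A where
  carrier := coinv ρA ρA
  mul_mem' ha hb := by simpa using smul_mem_coinv ρA ρA ha hb
  add_mem' ha hb := (coinv ρA ρA).add_mem ha hb
  algebraMap_mem' := algebraMap_mem_coinv ρA

/-- Left `B`-linearity of the coaction of `A`. -/
theorem coact_base_mul (ρA : EntwinedModule E A) (b : ρA.base) (a : A) :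
    ρA.coact (b * a) = (LinearMap.mulLeft R (b : A)).rTensor C (ρA.coact a) := by
  have h := coact_smul_coinv ρA ρA b.2 a
  have h' : actR R A A (b : A) = LinearMap.mulLeft R (b : A) := by ext; simp
  rwa [h'] at h

/-- A right `A`-module is a right module over any subalgebra of `A`. -/
instance restrictRight {M : Type*} [AddCommMonoid M] [Module Aᵐᵒᵖ M] (B : Subalgebra R A) : Module (↥B)ᵐᵒᵖ M :=
  Module.compHom M (RingHom.op B.val.toRingHom)

@[simp] theorem restrictRight_smul {M : Type*} [AddCommGroup M] [Module Aᵐᵒᵖ M]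
    (B : Subalgebra R A) (b : B) (m : M) :
    (op b : (↥B)ᵐᵒᵖ) • m = op (b : A) • m := rfl

/-- `M^{co 𝒞}` is a right `B`-module. -/
instance (ρA : EntwinedModule E A) (ρM : EntwinedModule E M) :
    Module (↥ρA.base)ᵐᵒᵖ (coinv ρA ρM) where
  smul b m := ⟨op ((unop b : ρA.base) : A) • (m : M), smul_mem_coinv ρA ρM m.2 (unop b).2⟩
  one_smul m := Subtype.ext (one_smul Aᵐᵒᵖ (m : M))
  mul_smul b b' m := Subtype.ext (mul_smul (op ((unop b : ρA.base) : A)) (op ((unop b' : ρA.base) : A)) (m : M))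
  smul_zero b := Subtype.ext (smul_zero (op ((unop b : ρA.base) : A)))
  smul_add b m m' := Subtype.ext (smul_add (op ((unop b : ρA.base) : A)) (m : M) m')
  add_smul b b' m := Subtype.ext (add_smul (op ((unop b : ρA.base) : A)) (op ((unop b' : ρA.base) : A)) (m : M))
  zero_smul m := Subtype.ext (zero_smul Aᵐᵒᵖ (m : M))

@[simp] theorem coe_op_smul (ρA : EntwinedModule E A) (ρM : EntwinedModule E M)
    (b : ρA.base) (m : coinv ρA ρM) : ((op b • m : coinv ρA ρM) : M) = op (b : A) • (m : M) :=
  rfl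

/-- The counit `Ψ_M : M^{co 𝒞} ⊗_B A → M, m ⊗ a ↦ m · a`. -/
def counitMap (ρA : EntwinedModule E A) (ρM : EntwinedModule E M) :
    BalancedTensor R ρA.base (coinv ρA ρM) A →ₗ[R] M :=
  BalancedTensor.lift ((actR R A M).domRestrict (coinv ρA ρM)) <| by
    intro n s l
    simp [Subalgebra.smul_def, mul_smul]

end Coinv

section Induced

variable {N : Type*} [AddCommGroup N] [Module R N]

instance (B : Subalgebra R A) : SMulCommClass (↥B) Aᵐᵒᵖ A where
  smul_comm b a x := by simp [Subalgebra.smul_def, mul_assoc]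

variable (ρA : EntwinedModule E A) [Module (↥ρA.base)ᵐᵒᵖ N]

/-- The coaction `n ⊗ a ↦ ∑ (n ⊗ a₀) ⊗ a₁` of `N ⊗_B A`. -/
def inducedCoact (ρA : EntwinedModule E A) (N : Type*) [AddCommGroup N] [Module R N]
    [Module (↥ρA.base)ᵐᵒᵖ N] :
    BalancedTensor R ρA.base N A →ₗ[R] BalancedTensor R ρA.base N A ⊗[R] C :=
  BalancedTensor.lift
    ((LinearMap.rTensorHom C ∘ₗ BalancedTensor.mk R ρA.base N A).compl₂ ρA.coact) <| by
    intro n b a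
    have h : BalancedTensor.mk R ρA.base N A (op b • n) =
        BalancedTensor.mk R ρA.base N A n ∘ₗ LinearMap.mulLeft R (b : A) :=
      LinearMap.ext fun x => BalancedTensor.smul_tmul n b x
    simp [h, LinearMap.rTensor_comp, Subalgebra.smul_def, coact_base_mul]

@[simp] theorem inducedCoact_tmul (n : N) (a : A) :
    inducedCoact ρA N (BalancedTensor.tmul R ρA.base n a) =
      (BalancedTensor.mk R ρA.base N A n).rTensor C (ρA.coact a) :=
  BalancedTensor.lift_tmul _ _ n a

/-- For a right `B`-module `N`, the entwined module `N ⊗_B A`. -/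
def induced (ρA : EntwinedModule E A) (N : Type*) [AddCommGroup N] [Module R N]
    [Module (↥ρA.base)ᵐᵒᵖ N] : EntwinedModule E (BalancedTensor R ρA.base N A) where
  coact := inducedCoact ρA N
  coassoc t := by
    have h : ∀ (f : A →ₗ[R] BalancedTensor R ρA.base N A) (u : (A ⊗[R] C) ⊗[R] C),
        TensorProduct.assoc R _ C C ((f.rTensor C).rTensor C u) =
          f.rTensor (C ⊗[R] C) (TensorProduct.assoc R A C C u) := fun f u => by
      induction u with
      | zero => simp
      | add x y hx hy => simp only [map_add, hx, hy]
      | tmul x c =>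
        induction x with
        | zero => simp
        | add x y hx hy => simp only [TensorProduct.add_tmul, map_add, hx, hy]
        | tmul a c' => simp
    suffices (TensorProduct.assoc R _ C C).toLinearMap ∘ₗ (inducedCoact ρA N).rTensor C ∘ₗ
        inducedCoact ρA N = LinearMap.lTensor _ Coalgebra.comul ∘ₗ inducedCoact ρA N from
      LinearMap.congr_fun this t
    refine BalancedTensor.hom_ext fun n a => ?_
    have hn : inducedCoact ρA N ∘ₗ BalancedTensor.mk R ρA.base N A n =
        (BalancedTensor.mk R ρA.base N A n).rTensor C ∘ₗ ρA.coact :=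
      LinearMap.ext fun x => inducedCoact_tmul ρA n x
    simp only [LinearMap.comp_apply, inducedCoact_tmul, LinearEquiv.coe_coe]
    rw [← LinearMap.comp_apply, ← LinearMap.rTensor_comp, hn, LinearMap.rTensor_comp,
      LinearMap.comp_apply, h, ρA.coassoc, ← LinearMap.comp_apply,
      LinearMap.rTensor_comp_lTensor, ← LinearMap.lTensor_comp_rTensor, LinearMap.comp_apply]
  counit t := by
    have h : ∀ (f : A →ₗ[R] BalancedTensor R ρA.base N A) (u : A ⊗[R] R),
        TensorProduct.rid R _ (f.rTensor R u) = f (TensorProduct.rid R A u) := fun f u => by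
      induction u with
      | zero => simp
      | add x y hx hy => simp only [map_add, hx, hy]
      | tmul x c => simp
    suffices (TensorProduct.rid R _).toLinearMap ∘ₗ LinearMap.lTensor _ Coalgebra.counit ∘ₗ
        inducedCoact ρA N = LinearMap.id from LinearMap.congr_fun this t
    refine BalancedTensor.hom_ext fun n a => ?_
    simp only [LinearMap.comp_apply, inducedCoact_tmul, LinearEquiv.coe_coe]
    rw [← LinearMap.comp_apply, LinearMap.lTensor_comp_rTensor, ← LinearMap.rTensor_comp_lTensor,
      LinearMap.comp_apply, h, ρA.counit]
    rfl
  coact_smul t a := by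
    suffices inducedCoact ρA N ∘ₗ Algebra.lsmul R R _ (op a) =
        rightMul E.psi _ a ∘ₗ inducedCoact ρA N from LinearMap.congr_fun this t
    refine BalancedTensor.hom_ext fun n x => ?_
    simp only [LinearMap.comp_apply, inducedCoact_tmul, Algebra.lsmul_coe,
      BalancedTensor.op_smul_tmul]
    rw [ρA.coact_smul, Entwining.rightMul_rTensor _ _ (fun m a => by simp)]

/-- The unit `Φ_N : N → (N ⊗_B A)^{co 𝒞}, n ↦ n ⊗ 1`. -/
def unitMap (ρA : EntwinedModule E A) (N : Type*) [AddCommGroup N] [Module R N]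
    [Module (↥ρA.base)ᵐᵒᵖ N] : N →ₗ[R] coinv ρA (induced ρA N) :=
  LinearMap.codRestrict _ ((BalancedTensor.mk R ρA.base N A).flip 1) <| by
    intro n
    rw [mem_coinv]
    have h : actR R A _ (BalancedTensor.tmul R ρA.base n (1 : A)) =
        BalancedTensor.mk R ρA.base N A n := by
      ext a; simp
    simp [h, grouplike, induced]

end Induced

section Galois

/-- The map `β : A ⊗_B A → A ⊗ C`, `a' ⊗ a ↦ ∑ a' a₀ ⊗ a₁ = ∑ a' 1₀ a_ψ ⊗ 1₁^ψ`. -/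
def galoisMap (ρA : EntwinedModule E A) : BalancedTensor R ρA.base A A →ₗ[R] A ⊗[R] C :=
  BalancedTensor.lift
    ((LinearMap.rTensorHom C ∘ₗ LinearMap.mul R A).compl₂ ρA.coact) <| by
    intro a' b a
    have h : LinearMap.mul R A (a' * b) = LinearMap.mul R A a' ∘ₗ
        LinearMap.mulLeft R (b : A) := by ext x; simp [mul_assoc]
    simp [h, LinearMap.rTensor_comp, Subalgebra.smul_def, coact_base_mul]

end Galois

end EntwinedModule

/-! ### The ring `#_ψ^op(C, A)` -/

/-- The underlying additive group `Hom_R(C, A)` of `#_ψ^op(C, A)`. -/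
def SmashOp {R : Type uR} {A : Type uA} {C : Type uC} [CommRing R] [Ring A]
    [Algebra R A] [AddCommGroup C] [Module R C] [Coalgebra R C] (_E : Entwining R A C) :
    Type (max uA uC) := C →ₗ[R] A

namespace SmashOp

variable {R : Type uR} {A : Type uA} {C : Type uC} [CommRing R] [Ring A]
    [Algebra R A] [AddCommGroup C] [Module R C] [Coalgebra R C] {E : Entwining R A C}

instance : AddCommGroup (SmashOp E) := inferInstanceAs (AddCommGroup (C →ₗ[R] A))

/-- The linear map underlying an element of `#_ψ^op(C, A)`. -/
def toLin : SmashOp E →+ (C →ₗ[R] A) := AddMonoidHom.id (C →ₗ[R] A)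

theorem toLin_injective : Function.Injective (toLin : SmashOp E →+ (C →ₗ[R] A)) := fun _ _ h => h

/-- The map `a ⊗ c ↦ a g(c)`. -/
def eval {R : Type uR} {A : Type uA} {C : Type uC} [CommRing R] [Ring A]
    [Algebra R A] [AddCommGroup C] [Module R C] (g : C →ₗ[R] A) : A ⊗[R] C →ₗ[R] A := LinearMap.mul' R A ∘ₗ g.lTensor A

@[simp] theorem eval_tmul {R : Type uR} {A : Type uA} {C : Type uC} [CommRing R] [Ring A]
    [Algebra R A] [AddCommGroup C] [Module R C] (g : C →ₗ[R] A) (a : A) (c : C) : eval g (a ⊗ₜ c) = a * g c := by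
  simp [eval]

/-- The product `(f · g)(c) = ∑ f(c₂)_ψ g(c₁^ψ)`. -/
instance : Mul (SmashOp E) where
  mul f g := (eval (toLin g) ∘ₗ E.psi ∘ₗ (toLin f).lTensor C ∘ₗ Coalgebra.comul : C →ₗ[R] A)

/-- The unit `c ↦ ε(c) 1`. -/
instance : One (SmashOp E) where
  one := (Algebra.linearMap R A ∘ₗ Coalgebra.counit : C →ₗ[R] A)

theorem toLin_mul (f g : SmashOp E) (c : C) :
    toLin (f * g) c = eval (toLin g) (E.psi ((toLin f).lTensor C (Coalgebra.comul c))) := rfl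

theorem toLin_one (c : C) :
    toLin (1 : SmashOp E) c = algebraMap R A (Coalgebra.counit c) := rfl

theorem eval_mul_left {R : Type uR} {A : Type uA} {C : Type uC} [CommRing R] [Ring A]
    [Algebra R A] [AddCommGroup C] [Module R C] (g : C →ₗ[R] A) (a : A) (t : A ⊗[R] C) :
    eval g ((LinearMap.mulLeft R a).rTensor C t) = a * eval g t := by
  induction t with
  | zero => simp
  | add x y hx hy => simp only [map_add, mul_add, hx, hy]
  | tmul x c => simp [mul_assoc]

/-- The map `a ⊗ (x ⊗ y) ↦ ∑ a g(y)_ψ ⊗ x^ψ`. -/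
def rTwist (E : Entwining R A C) (g : C →ₗ[R] A) : A ⊗[R] (C ⊗[R] C) →ₗ[R] A ⊗[R] C :=
  actTensor R A C A ∘ₗ (E.psi ∘ₗ g.lTensor C).lTensor A

theorem rTwist_tmul (g : C →ₗ[R] A) (a : A) (x y : C) :
    rTwist E g (a ⊗ₜ (x ⊗ₜ y)) = (LinearMap.mulLeft R a).rTensor C (E.psi (x ⊗ₜ g y)) := by
  have h' : actR R A A a = LinearMap.mulLeft R a := by ext; simp
  simp [rTwist, h']

theorem eval_mul (f g : SmashOp E) (t : A ⊗[R] C) :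
    eval (toLin (f * g)) t = eval (toLin g) (rTwist E (toLin f) (Coalgebra.comul.lTensor A t)) := by
  induction t with
  | zero => simp
  | add x y hx hy => simp only [map_add, hx, hy]
  | tmul a c =>
    have h' : actR R A A a = LinearMap.mulLeft R a := by ext; simp
    simp [toLin_mul, rTwist, h', eval_mul_left]

theorem rTwist_assoc (g : C →ₗ[R] A) (t : A ⊗[R] C) (y : C) :
    rTwist E g (TensorProduct.assoc R A C C (t ⊗ₜ y)) = rightMul E.psi A (g y) t := by
  induction t with
  | zero => simp
  | add x y hx hy => simp only [TensorProduct.add_tmul, map_add, hx, hy]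
  | tmul a c =>
    have h' : actR R A A a = LinearMap.mulLeft R a := by ext; simp
    simp [rTwist_tmul, h']

theorem psi_eval (g : C →ₗ[R] A) (x : C) (t : A ⊗[R] C) :
    E.psi (x ⊗ₜ eval g t) = rTwist E g (TensorProduct.assoc R A C C (E.psi.rTensor C
      ((TensorProduct.assoc R C A C).symm (x ⊗ₜ t)))) := by
  induction t with
  | zero => simp
  | add x y hx hy => simp only [TensorProduct.tmul_add, map_add, hx, hy]
  | tmul a c => simp [rTwist_assoc, E.psi_mul]

/-- Twisting first by `f` and then by `g` amounts to twisting by `f · g`. -/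
theorem rTwist_rTwist (f g : SmashOp E) (c : C) :
    rTwist E (toLin g) (Coalgebra.comul.lTensor A
        (E.psi ((toLin f).lTensor C (Coalgebra.comul c)))) =
      E.psi ((toLin (f * g)).lTensor C (Coalgebra.comul c)) := by
  let F : C ⊗[R] (C ⊗[R] C) →ₗ[R] A ⊗[R] C :=
    E.psi ∘ₗ (eval (toLin g) ∘ₗ E.psi ∘ₗ (toLin f).lTensor C).lTensor C
  have h1 : ∀ u : C ⊗[R] C, E.psi ((toLin (f * g)).lTensor C u) =
      F (Coalgebra.comul.lTensor C u) := by
    intro u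
    induction u with
    | zero => simp
    | add x y hx hy => simp only [map_add, hx, hy]
    | tmul x y => simp [F, toLin_mul]
  have h2 : ∀ u : C ⊗[R] C, rTwist E (toLin g) (Coalgebra.comul.lTensor A
      (E.psi ((toLin f).lTensor C u))) =
      F (TensorProduct.assoc R C C C (Coalgebra.comul.rTensor C u)) := by
    intro u
    induction u with
    | zero => simp
    | add x y hx hy => simp only [map_add, hx, hy]
    | tmul x y =>
      rw [LinearMap.lTensor_tmul, E.psi_comul, LinearMap.rTensor_tmul]
      generalize (Coalgebra.comul x : C ⊗[R] C) = v
      induction v with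
      | zero => simp
      | add x y hx hy => simp only [TensorProduct.add_tmul, map_add, hx, hy]
      | tmul v w => simp [F, psi_eval]
  rw [h1, h2, Coalgebra.coassoc_apply]

theorem eval_add {R : Type uR} {A : Type uA} {C : Type uC} [CommRing R] [Ring A]
    [Algebra R A] [AddCommGroup C] [Module R C] (f g : C →ₗ[R] A) (t : A ⊗[R] C) :
    eval (f + g) t = eval f t + eval g t := by
  simp [eval, LinearMap.lTensor_add]

theorem eval_zero {R : Type uR} {A : Type uA} {C : Type uC} [CommRing R] [Ring A]
    [Algebra R A] [AddCommGroup C] [Module R C] (t : A ⊗[R] C) :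
    eval (0 : C →ₗ[R] A) t = 0 := by
  simp [eval]

theorem eval_one (t : A ⊗[R] C) :
    eval (toLin (1 : SmashOp E)) t = TensorProduct.rid R A (Coalgebra.counit.lTensor A t) := by
  induction t with
  | zero => simp
  | add x y hx hy => simp only [map_add, hx, hy]
  | tmul a c => simp [toLin_one, Algebra.smul_def, Algebra.commutes]

instance : Ring (SmashOp E) :=
  { (inferInstance : AddCommGroup (SmashOp E)) with
    mul_assoc := fun f g h => toLin_injective <| LinearMap.ext fun c => by
      rw [toLin_mul, ← rTwist_rTwist, toLin_mul, eval_mul]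
    one_mul := fun f => toLin_injective <| LinearMap.ext fun c => by
      have h : ∀ u : C ⊗[R] C, E.psi ((toLin (1 : SmashOp E)).lTensor C u) =
          (1 : A) ⊗ₜ[R] TensorProduct.rid R C (Coalgebra.counit.lTensor C u) := by
        intro u
        induction u with
        | zero => simp
        | add x y hx hy => simp only [map_add, TensorProduct.tmul_add, hx, hy]
        | tmul x y =>
          simp [toLin_one, Algebra.algebraMap_eq_smul_one, E.psi_one]
      simp [toLin_mul, h]
    mul_one := fun f => toLin_injective <| LinearMap.ext fun c => by
      have h : ∀ u : C ⊗[R] C, eval (toLin (1 : SmashOp E)) (E.psi ((toLin f).lTensor C u)) =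
          toLin f (TensorProduct.lid R C (Coalgebra.counit.rTensor C u)) := by
        intro u
        induction u with
        | zero => simp
        | add x y hx hy => simp only [map_add, hx, hy]
        | tmul x y => simp [eval_one, E.psi_counit]
      simp [toLin_mul, h]
    left_distrib := fun f g h => toLin_injective <| LinearMap.ext fun c => by
      simp [toLin_mul, eval_add]
    right_distrib := fun f g h => toLin_injective <| LinearMap.ext fun c => by
      simp [toLin_mul, LinearMap.lTensor_add]
    zero_mul := fun f => toLin_injective <| LinearMap.ext fun c => by
      simp [toLin_mul]
    mul_zero := fun f => toLin_injective <| LinearMap.ext fun c => by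
      simp [toLin_mul, eval_zero] }

theorem eval_coact_mul (ρA : EntwinedModule E A) (f g : SmashOp E) (a : A) :
    eval (toLin (f * g)) (ρA.coact a) =
      eval (toLin g) (ρA.coact (eval (toLin f) (ρA.coact a))) := by
  have h : ∀ u : A ⊗[R] C, rTwist E (toLin f) (TensorProduct.assoc R A C C
      (ρA.coact.rTensor C u)) = ρA.coact (eval (toLin f) u) := by
    intro u
    induction u with
    | zero => simp
    | add x y hx hy => simp only [map_add, hx, hy]
    | tmul x c => simpa [rTwist_assoc] using (ρA.coact_smul x (toLin f c)).symm
  rw [eval_mul, ← ρA.coassoc, h]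

/-- The left `B`-linear map `a ↦ a ↼ g = ∑ a₀ g(a₁)`. -/
def harpoon (ρA : EntwinedModule E A) (g : SmashOp E) : Module.End ρA.base A where
  toFun a := eval (toLin g) (ρA.coact a)
  map_add' a b := by simp
  map_smul' b a := by
    simp [Subalgebra.smul_def, EntwinedModule.coact_base_mul, eval_mul_left]

@[simp] theorem harpoon_apply (ρA : EntwinedModule E A) (g : SmashOp E) (a : A) :
    harpoon ρA g a = eval (toLin g) (ρA.coact a) := rfl

/-- The ring morphism `Λ : #_ψ^op(C, A) → End(_B A)^op`, `g ↦ (a ↦ a ↼ g)`. -/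
def Lambda (ρA : EntwinedModule E A) : SmashOp E →+* (Module.End ρA.base A)ᵐᵒᵖ where
  toFun g := op (harpoon ρA g)
  map_one' := unop_injective <| LinearMap.ext fun a => by
    simp [eval_one, ρA.counit]
  map_mul' f g := unop_injective <| LinearMap.ext fun a => by
    simp [eval_coact_mul]
  map_zero' := unop_injective <| LinearMap.ext fun a => by
    simp [eval_zero]
  map_add' f g := unop_injective <| LinearMap.ext fun a => by
    simp [eval_add]

end SmashOp

/-! ### The properties in the theorem -/

namespace EntwinedModule

variable {R : Type uR} {A : Type uA} {C : Type uC} [CommRing R] [Ring A]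
    [Algebra R A] [AddCommGroup C] [Module R C] [Coalgebra R C] {E : Entwining R A C}

/-- The weak structure theorem: `Ψ_M` is an isomorphism for every entwined module `M`. -/
def WeakStructureTheorem (ρA : EntwinedModule E A) : Prop :=
  ∀ (M : Type (max uA uC w)) [AddCommGroup M] [Module R M] [Module Aᵐᵒᵖ M]
    [IsScalarTower R Aᵐᵒᵖ M] (ρM : EntwinedModule E M),
    Function.Bijective (counitMap ρA ρM)

/-- The strong structure theorem: moreover `Φ_N` is an isomorphism for every right
`B`-module `N`. -/
def StrongStructureTheorem (ρA : EntwinedModule E A) : Prop :=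
  WeakStructureTheorem.{uR, uA, uC, w} ρA ∧
  ∀ (N : Type (max uA uC w)) [AddCommGroup N] [Module R N] [Module (↥ρA.base)ᵐᵒᵖ N]
    [IsScalarTower R (↥ρA.base)ᵐᵒᵖ N],
    Function.Bijective (unitMap ρA N)

/-- `A/B` is `𝒞`-Galois: `β` is bijective. -/
def IsGaloisExt (ρA : EntwinedModule E A) : Prop :=
  Function.Bijective (galoisMap ρA)

/-- `A/B` is cleft: there is an integral `λ : C → A` (a `C`-colinear map) which is
invertible for the convolution product. -/
def IsCleft (ρA : EntwinedModule E A) : Prop :=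
  ∃ l : WithConv (C →ₗ[R] A), IsColinear Coalgebra.comul ρA.coact l.ofConv ∧ IsUnit l

/-- The right normal basis property: there is a left `B`-linear right `C`-colinear
isomorphism `A ≃ B ⊗ C`. -/
def NormalBasis (ρA : EntwinedModule E A) : Prop :=
  ∃ θ : A ≃ₗ[ρA.base] (ρA.base ⊗[R] C),
    IsColinear ρA.coact
      ((TensorProduct.assoc R ρA.base C C).symm.toLinearMap ∘ₗ
        Coalgebra.comul.lTensor ρA.base)
      (θ.toLinearMap.restrictScalars R)

end EntwinedModule

end

/-! ### Actions by maps `C → A` and convolution -/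

/-! Write `λ` for an integral and `μ` for its convolution inverse. Cleftness enters through one
identity, `psi_inverse`: `∑ μ(c₂)_ψ ⊗ c₁^ψ = μ(c) 1₀ ⊗ 1₁`. It makes `p(m) = ∑ m₀ μ(m₁)` coinvariant
for every entwined module `M`. Since `μ ⋆ λ = ε`, one has `∑ p(m₀) λ(m₁) = m`, so `m ↦ ∑ p(m₀) ⊗
λ(m₁)` inverts `Ψ_M`. Since `λ ⋆ μ = ε`, one has `p(λ(c)) = ε(c)`, so `a ↦ ∑ p(a₀) ⊗ a₁` and `b ⊗ c
↦ b λ(c)` are mutually inverse and give a normal basis. Thus (1) implies (2).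

For (2) ⇒ (3), the weak structure theorem is applied to the single entwined module `A ⊗ C`: its
coinvariants are the multiples `a · ϱ(1)`, a copy of `A`, and under this identification `Ψ` becomes
`β`.

For (3) ⇒ (4), left `A`-linear maps to `A` out of `A ⊗ C` are `Hom_R(C, A)`, those out of `A ⊗_B A`
are the left `B`-linear endomorphisms of `A`, and precomposition with `β` is `Λ`.

For (4) ⇒ (1), a normal basis `θ` gives the integral `λ = θ⁻¹(1 ⊗ -)`, with `(λ ⋆ g)(c) =
Λ(g)(λ(c))`. Because `λ(C)` generates `A` over `B`, injectivity of `Λ` makes `λ` left cancellable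
and surjectivity gives a right inverse, which is then two-sided.

For (5), the triangle identity shows that `Φ_N ⊗_B A` is bijective once `Ψ` is bijective at `N ⊗_B
A`. The normal basis identifies `- ⊗_B A` with `- ⊗_R C`, which reflects isomorphisms when `C` is
faithfully flat. -/

noncomputable section

namespace EntwinedModule

variable {R : Type uR} {A : Type uA} {C : Type uC} [CommRing R] [Ring A]
    [Algebra R A] [AddCommGroup C] [Module R C]

section ActBy

variable {M : Type*} [AddCommGroup M] [Module R M] [Module Aᵐᵒᵖ M] [IsScalarTower R Aᵐᵒᵖ M]
  {N : Type*} [AddCommGroup N] [Module R N] [Module Aᵐᵒᵖ N] [IsScalarTower R Aᵐᵒᵖ N]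

variable (M) in
/-- For a right `A`-module `M` and `g : C → A`, the map `m ⊗ c ↦ m · g(c)`. -/
def actBy (g : C →ₗ[R] A) : M ⊗[R] C →ₗ[R] M :=
  TensorProduct.lift (actR R A M) ∘ₗ g.lTensor M

@[simp] theorem actBy_tmul (g : C →ₗ[R] A) (m : M) (c : C) :
    actBy M g (m ⊗ₜ c) = op (g c) • m := by
  simp [actBy]

theorem actBy_self (g : C →ₗ[R] A) (t : A ⊗[R] C) : actBy A g t = SmashOp.eval g t := by
  induction t with
  | zero => simp
  | add x y hx hy => simp only [map_add, hx, hy]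
  | tmul a c => simp

theorem actBy_rTensor (g : C →ₗ[R] A) (f : M →ₗ[R] N)
    (hf : ∀ m (a : A), f (op a • m) = op a • f m) (t : M ⊗[R] C) :
    actBy N g (f.rTensor C t) = f (actBy M g t) := by
  induction t with
  | zero => simp
  | add x y hx hy => simp only [map_add, hx, hy]
  | tmul a c => simp [hf]

variable [Coalgebra R C]

theorem actBy_actBy (f g : WithConv (C →ₗ[R] A)) (t : M ⊗[R] C) :
    actBy M g.ofConv ((actBy M f.ofConv).rTensor C ((TensorProduct.assoc R M C C).symm
      (Coalgebra.comul.lTensor M t))) = actBy M (f * g).ofConv t := by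
  induction t with
  | zero => simp
  | add x y hx hy => simp only [map_add, hx, hy]
  | tmul m c =>
    rw [actBy_tmul, LinearMap.lTensor_tmul, show (f * g).ofConv c = (f * g) c from rfl,
      LinearMap.convMul_apply]
    generalize (Coalgebra.comul c : C ⊗[R] C) = v
    induction v with
    | zero => simp
    | add x y hx hy => simp only [TensorProduct.tmul_add, map_add, hx, hy, op_add, add_smul]
    | tmul x y => simp [mul_smul]

theorem actBy_one (t : M ⊗[R] C) : actBy M (1 : WithConv (C →ₗ[R] A)).ofConv t =
    TensorProduct.rid R M (Coalgebra.counit.lTensor M t) := by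
  induction t with
  | zero => simp
  | add x y hx hy => simp only [map_add, hx, hy]
  | tmul m c => simp [LinearMap.convOne_def, Algebra.algebraMap_eq_smul_one]

variable {E : Entwining R A C}

/-- Both sides are `∑ m₀ f(m₁) g(m₂)`; coassociativity of `ϱ` reduces this to `actBy_actBy`. -/
theorem actBy_actBy_coact (ρM : EntwinedModule E M) (f g : WithConv (C →ₗ[R] A)) (m : M) :
    actBy M g.ofConv ((actBy M f.ofConv ∘ₗ ρM.coact).rTensor C (ρM.coact m)) =
      actBy M (f * g).ofConv (ρM.coact m) := by
  rw [← actBy_actBy, ← ρM.coassoc, LinearEquiv.symm_apply_apply, LinearMap.rTensor_comp,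
    LinearMap.comp_apply]

theorem actBy_one_coact (ρM : EntwinedModule E M) (m : M) :
    actBy M (1 : WithConv (C →ₗ[R] A)).ofConv (ρM.coact m) = m := by
  rw [actBy_one, ρM.counit]

/-- The coaction of `∑ m₀ · g(m₁)`. -/
theorem coact_actBy_coact (ρM : EntwinedModule E M) (g : C →ₗ[R] A) (m : M) :
    ρM.coact (actBy M g (ρM.coact m)) =
      actTensor R A C M ((E.psi ∘ₗ g.lTensor C ∘ₗ Coalgebra.comul).lTensor M (ρM.coact m)) := by
  -- The entwining condition is used on arbitrary tensors `u`; coassociativity enters only when `u =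
  -- ϱ(m)`.
  have h : ∀ u : M ⊗[R] C, ρM.coact (actBy M g u) =
      actTensor R A C M ((E.psi ∘ₗ g.lTensor C).lTensor M
        (TensorProduct.assoc R M C C (ρM.coact.rTensor C u))) := by
    intro u
    induction u with
    | zero => simp
    | add x y hx hy => simp only [map_add, hx, hy]
    | tmul m c =>
      rw [actBy_tmul, ρM.coact_smul, LinearMap.rTensor_tmul]
      generalize ρM.coact m = v
      induction v with
      | zero => simp
      | add x y hx hy => simp only [TensorProduct.add_tmul, map_add, hx, hy]
      | tmul x y => simp
  rw [h, ρM.coassoc, ← LinearMap.comp_apply (LinearMap.lTensor M _), ← LinearMap.lTensor_comp,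
    LinearMap.comp_assoc]

end ActBy

/-! ### Convolution action on maps `C → X` -/

section Convolution

variable [Coalgebra R C] {X : Type*} [AddCommGroup X] [Module R X] [Module A X]
  [IsScalarTower R A X]

variable (R A X) in
/-- The action `a ⊗ x ↦ a · x` of a left `A`-module. -/
def actL : A ⊗[R] X →ₗ[R] X := TensorProduct.lift (Algebra.lsmul R R X).toLinearMap

@[simp] theorem actL_tmul (a : A) (x : X) : actL R A X (a ⊗ₜ x) = a • x := rfl

/-- The convolution `(f ▷ F)(c) = ∑ f(c₁) · F(c₂)` of `f : C → A` with `F : C → X`. -/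
def convAct (f : WithConv (C →ₗ[R] A)) (F : C →ₗ[R] X) : C →ₗ[R] X :=
  actL R A X ∘ₗ TensorProduct.map f.ofConv F ∘ₗ Coalgebra.comul

/-- With `convAct_one`, this makes `Hom_R(C, X)` a left module over the convolution algebra, so that
convolution units can be cancelled. -/
theorem convAct_mul (f g : WithConv (C →ₗ[R] A)) (F : C →ₗ[R] X) :
    convAct (f * g) F = convAct f (convAct g F) := by
  -- Both sides are `T` applied to an iterated comultiplication, with the two possible bracketings.
  let T : C ⊗[R] (C ⊗[R] C) →ₗ[R] X :=
    actL R A X ∘ₗ TensorProduct.map f.ofConv (actL R A X ∘ₗ TensorProduct.map g.ofConv F)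
  have h1 : ∀ u : C ⊗[R] C, actL R A X (TensorProduct.map (f * g).ofConv F u) =
      T (TensorProduct.assoc R C C C (Coalgebra.comul.rTensor C u)) := by
    intro u
    induction u with
    | zero => simp
    | add x y hx hy => simp only [map_add, hx, hy]
    | tmul x y =>
      rw [TensorProduct.map_tmul, show (f * g).ofConv x = (f * g) x from rfl,
        LinearMap.convMul_apply, LinearMap.rTensor_tmul]
      generalize (Coalgebra.comul x : C ⊗[R] C) = v
      induction v with
      | zero => simp
      | add x y hx hy => simp only [TensorProduct.add_tmul, map_add, hx, hy]
      | tmul x y => simp [T, mul_smul]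
  have h2 : ∀ u : C ⊗[R] C, actL R A X (TensorProduct.map f.ofConv (convAct g F) u) =
      T (Coalgebra.comul.lTensor C u) := by
    intro u
    induction u with
    | zero => simp
    | add x y hx hy => simp only [map_add, hx, hy]
    | tmul x y => simp [T, convAct]
  ext c
  rw [convAct, convAct, LinearMap.comp_apply, LinearMap.comp_apply, LinearMap.comp_apply,
    LinearMap.comp_apply, h1, h2, Coalgebra.coassoc_apply]

theorem convAct_one (F : C →ₗ[R] X) : convAct (1 : WithConv (C →ₗ[R] A)) F = F := by
  have h : ∀ u : C ⊗[R] C, actL R A X (TensorProduct.map (1 : WithConv (C →ₗ[R] A)).ofConv F u) =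
      F (TensorProduct.lid R C (Coalgebra.counit.rTensor C u)) := by
    intro u
    induction u with
    | zero => simp
    | add x y hx hy => simp only [map_add, hx, hy]
    | tmul x y => simp [LinearMap.convOne_def]
  ext c
  simp [convAct, h]

/-- Convolution of `f : C → A` with `c ↦ g(c) · x`. -/
theorem convAct_smulRight (f g : WithConv (C →ₗ[R] A)) (x : X) :
    convAct f ((Algebra.lsmul R R X).toLinearMap.flip x ∘ₗ g.ofConv) =
      (Algebra.lsmul R R X).toLinearMap.flip x ∘ₗ (f * g).ofConv := by
  ext c
  rw [LinearMap.comp_apply, show (f * g).ofConv c = (f * g) c from rfl, LinearMap.convMul_apply,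
    convAct, LinearMap.comp_apply, LinearMap.comp_apply]
  generalize (Coalgebra.comul c : C ⊗[R] C) = v
  induction v with
  | zero => simp
  | add x y hx hy => simp only [map_add, hx, hy]
  | tmul x y => simp

theorem convAct_injective {f : WithConv (C →ₗ[R] A)} (hf : IsUnit f) :
    Function.Injective (convAct f : (C →ₗ[R] X) → (C →ₗ[R] X)) := by
  obtain ⟨u, rfl⟩ := hf
  intro F G h
  have := congrArg (convAct (↑u⁻¹ : WithConv (C →ₗ[R] A))) h
  rwa [← convAct_mul, ← convAct_mul, Units.inv_mul, convAct_one, convAct_one] at this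

end Convolution

/-! ### Integrals and cleft extensions -/

section Integral

theorem smul_eq_rTensor_actR (a : A) (t : A ⊗[R] C) : a • t = (actR R A A a).rTensor C t := by
  induction t with
  | zero => simp
  | add x y hx hy => simp only [smul_add, map_add, hx, hy]
  | tmul x y => simp [TensorProduct.smul_tmul']

variable [Coalgebra R C] {E : Entwining R A C} {ρA : EntwinedModule E A}

/-- Colinearity of an integral reads `ϱ(λ(c)) = λ(c₁) ⊗ c₂`; after substituting it, convolution
products appear through this formula. -/
theorem actBy_rTensor_comul (f g : WithConv (C →ₗ[R] A)) (c : C) :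
    actBy A g.ofConv (f.ofConv.rTensor C (Coalgebra.comul c)) = (f * g).ofConv c := by
  rw [show (f * g).ofConv c = (f * g) c from rfl, LinearMap.convMul_apply]
  generalize (Coalgebra.comul c : C ⊗[R] C) = v
  induction v with
  | zero => simp
  | add x y hx hy => simp only [map_add, hx, hy]
  | tmul x y => simp

theorem actTensor_lTensor_rTensor (f : WithConv (C →ₗ[R] A)) (F : C →ₗ[R] A ⊗[R] C) (c : C) :
    actTensor R A C A (F.lTensor A (f.ofConv.rTensor C (Coalgebra.comul c))) = convAct f F c := by
  rw [convAct, LinearMap.comp_apply, LinearMap.comp_apply]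
  generalize (Coalgebra.comul c : C ⊗[R] C) = v
  induction v with
  | zero => simp
  | add x y hx hy => simp only [map_add, hx, hy]
  | tmul x y => simp [smul_eq_rTensor_actR]

/-- If `λ` is an integral with convolution inverse `μ`, then
`∑ μ(c₂)_ψ ⊗ c₁^ψ = ∑ μ(c) 1₀ ⊗ 1₁`. -/
theorem psi_inverse {l : (WithConv (C →ₗ[R] A))ˣ}
    (hl : IsColinear Coalgebra.comul ρA.coact l.1.ofConv) :
    E.psi ∘ₗ l⁻¹.1.ofConv.lTensor C ∘ₗ Coalgebra.comul =
      (Algebra.lsmul R R (A ⊗[R] C)).toLinearMap.flip ρA.grouplike ∘ₗ l⁻¹.1.ofConv := by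
  -- It suffices to compare after convolving with `λ` on the left. By colinearity of `λ` the left
  -- side becomes `ϱ(∑ λ(c₁) μ(c₂)) = ε(c) ϱ(1)`; the right side becomes `(λ ⋆ μ)(c) ϱ(1)`.
  apply convAct_injective l.isUnit
  rw [convAct_smulRight, Units.mul_inv]
  ext c
  rw [← actTensor_lTensor_rTensor, ← hl, ← coact_actBy_coact, hl, actBy_rTensor_comul,
    Units.mul_inv]
  simp [LinearMap.convOne_def, Algebra.algebraMap_eq_smul_one, grouplike]

variable {M : Type*} [AddCommGroup M] [Module R M] [Module Aᵐᵒᵖ M] [IsScalarTower R Aᵐᵒᵖ M]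

/-- The coaction of `∑ m₀ μ(m₁)` is `∑ m₀ μ(m₂)_ψ ⊗ m₁^ψ`, which `psi_inverse` rewrites as `∑ m₀
μ(m₁) 1₀ ⊗ 1₁`. -/
theorem actBy_inverse_mem_coinv {l : (WithConv (C →ₗ[R] A))ˣ}
    (hl : IsColinear Coalgebra.comul ρA.coact l.1.ofConv) (ρM : EntwinedModule E M) (m : M) :
    actBy M l⁻¹.1.ofConv (ρM.coact m) ∈ coinv ρA ρM := by
  rw [mem_coinv, coact_actBy_coact, psi_inverse hl]
  generalize ρM.coact m = u
  induction u with
  | zero => simp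
  | add x y hx hy => simp only [map_add, hx, hy, LinearMap.rTensor_add, LinearMap.add_apply]
  | tmul x c =>
    have h : actR R A M (op (l⁻¹.1.ofConv c) • x) =
        actR R A M x ∘ₗ actR R A A (l⁻¹.1.ofConv c) := by
      ext a; simp [mul_smul]
    rw [actBy_tmul, h, LinearMap.rTensor_comp, LinearMap.comp_apply]
    simp [smul_eq_rTensor_actR]

/-- The map `M → M^{co 𝒞}, m ↦ ∑ m₀ · μ(m₁)`, for `μ` the convolution inverse of an integral. -/
def coinvProj {l : (WithConv (C →ₗ[R] A))ˣ}
    (hl : IsColinear Coalgebra.comul ρA.coact l.1.ofConv) (ρM : EntwinedModule E M) :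
    M →ₗ[R] coinv ρA ρM :=
  LinearMap.codRestrict _ (actBy M l⁻¹.1.ofConv ∘ₗ ρM.coact) (actBy_inverse_mem_coinv hl ρM)

theorem coe_coinvProj {l : (WithConv (C →ₗ[R] A))ˣ}
    (hl : IsColinear Coalgebra.comul ρA.coact l.1.ofConv) (ρM : EntwinedModule E M) (m : M) :
    (coinvProj hl ρM m : M) = actBy M l⁻¹.1.ofConv (ρM.coact m) := rfl

/-- `∑ p(m₀) · λ(m₁) = m`. -/
theorem actBy_coinvProj {l : (WithConv (C →ₗ[R] A))ˣ}
    (hl : IsColinear Coalgebra.comul ρA.coact l.1.ofConv) (ρM : EntwinedModule E M) (m : M) :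
    actBy M l.1.ofConv (((coinv ρA ρM).subtype ∘ₗ coinvProj hl ρM).rTensor C (ρM.coact m)) = m := by
  have h : (coinv ρA ρM).subtype ∘ₗ coinvProj hl ρM = actBy M l⁻¹.1.ofConv ∘ₗ ρM.coact := rfl
  rw [h, actBy_actBy_coact, Units.inv_mul, actBy_one_coact]

/-- The projection `coinvProj` of `A` onto `B`. -/
def baseProj {l : (WithConv (C →ₗ[R] A))ˣ}
    (hl : IsColinear Coalgebra.comul ρA.coact l.1.ofConv) : A →ₗ[R] ρA.base :=
  coinvProj hl ρA

/-- `p(n · a) = n · p(a)` for `n` coinvariant. -/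
theorem coinvProj_smul {l : (WithConv (C →ₗ[R] A))ˣ}
    (hl : IsColinear Coalgebra.comul ρA.coact l.1.ofConv) (ρM : EntwinedModule E M)
    (n : coinv ρA ρM) (a : A) :
    coinvProj hl ρM (op a • (n : M)) = op (baseProj hl a) • n := by
  apply Subtype.ext
  rw [coe_op_smul, coe_coinvProj, coact_smul_coinv ρA ρM n.2,
    actBy_rTensor _ _ fun m a => by simp [mul_smul]]
  rfl

theorem counitMap_tmul (ρA : EntwinedModule E A) (ρM : EntwinedModule E M) (n : coinv ρA ρM)
    (a : A) : counitMap ρA ρM (BalancedTensor.tmul R ρA.base n a) = op a • (n : M) :=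
  BalancedTensor.lift_tmul _ _ n a

/-- For a cleft extension, `Ψ_M` has the inverse `m ↦ ∑ p(m₀) ⊗ λ(m₁)`. -/
theorem counitMap_bijective {l : (WithConv (C →ₗ[R] A))ˣ}
    (hl : IsColinear Coalgebra.comul ρA.coact l.1.ofConv) (ρM : EntwinedModule E M) :
    Function.Bijective (counitMap ρA ρM) := by
  let T : M ⊗[R] C →ₗ[R] BalancedTensor R ρA.base (coinv ρA ρM) A :=
    BalancedTensor.proj R ρA.base (coinv ρA ρM) A ∘ₗ
      TensorProduct.map (coinvProj hl ρM) l.1.ofConv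
  refine Function.bijective_iff_has_inverse.2 ⟨T ∘ₗ ρM.coact, ?_, ?_⟩
  · suffices (T ∘ₗ ρM.coact) ∘ₗ counitMap ρA ρM = LinearMap.id from LinearMap.congr_fun this
    refine BalancedTensor.hom_ext fun n a => ?_
    -- For `u = x ⊗ c`: `p(n x) ⊗ λ(c) = n p(x) ⊗ λ(c) = n ⊗ p(x) λ(c)`, because `p(x)` lies in `B`.
    -- For `u = ϱ(a)` the result is `n ⊗ a`.
    have h : ∀ u : A ⊗[R] C, T ((actR R A M (n : M)).rTensor C u) = BalancedTensor.tmul R ρA.base n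
        (actBy A l.1.ofConv (((coinv ρA ρA).subtype ∘ₗ coinvProj hl ρA).rTensor C u)) := by
      intro u
      induction u with
      | zero => simp [BalancedTensor.tmul_zero]
      | add x y hx hy => simp only [map_add, hx, hy, BalancedTensor.tmul_add]
      | tmul x c =>
        have : T ((actR R A M (n : M)).rTensor C (x ⊗ₜ c)) = BalancedTensor.tmul R ρA.base
          (coinvProj hl ρM (op x • (n : M))) (l.1.ofConv c) := rfl
        rw [this, coinvProj_smul, BalancedTensor.smul_tmul]
        simp [Subalgebra.smul_def, baseProj]
        rfl
    rw [LinearMap.comp_apply, counitMap_tmul, LinearMap.comp_apply,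
      coact_smul_coinv ρA ρM n.2, h, actBy_coinvProj]
    rfl
  · intro m
    have h : ∀ u : M ⊗[R] C, counitMap ρA ρM (T u) =
        actBy M l.1.ofConv (((coinv ρA ρM).subtype ∘ₗ coinvProj hl ρM).rTensor C u) := by
      intro u
      induction u with
      | zero => simp
      | add x y hx hy => simp only [map_add, hx, hy]
      | tmul x c =>
        have : T (x ⊗ₜ c) = BalancedTensor.tmul R ρA.base (coinvProj hl ρM x) (l.1.ofConv c) := rfl
        rw [this, counitMap_tmul]
        simp
    exact (h _).trans (actBy_coinvProj hl ρM m)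

/-- A cleft extension has the right normal basis property. -/
theorem normalBasis_of_integral {l : (WithConv (C →ₗ[R] A))ˣ}
    (hl : IsColinear Coalgebra.comul ρA.coact l.1.ofConv) : ρA.NormalBasis := by
  let p := baseProj hl
  have hp : ∀ (b : ρA.base) a, p (b * a) = b * p a := fun b a => coinvProj_smul hl ρA b a
  -- By colinearity `p(λ(c)) = ∑ λ(c₁) μ(c₂) = ε(c)`; this will give `θ(λ(c)) = 1 ⊗ c`.
  have hpl : ∀ c, p (l.1.ofConv c) = algebraMap R ρA.base (Coalgebra.counit c) := fun c => by
    apply Subtype.ext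
    change actBy A l⁻¹.1.ofConv (ρA.coact (l.1.ofConv c)) = _
    rw [hl, actBy_rTensor_comul, Units.mul_inv]
    rfl
  let θ : A →ₗ[ρA.base] ρA.base ⊗[R] C :=
    { toFun := fun a => p.rTensor C (ρA.coact a)
      map_add' := fun a b => by simp
      map_smul' := fun b a => by
        rw [Subalgebra.smul_def, smul_eq_mul, coact_base_mul]
        generalize ρA.coact a = u
        induction u with
        | zero => simp
        | add x y hx hy => simp only [smul_add, map_add, hx, hy]
        | tmul x c => simp [hp, TensorProduct.smul_tmul'] }
  let ζ : ρA.base ⊗[R] C →ₗ[R] A := actBy A l.1.ofConv ∘ₗ ρA.base.val.toLinearMap.rTensor C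
  have hζθ : ∀ a, ζ (θ a) = a := fun a => by
    refine Eq.trans ?_ (actBy_coinvProj hl ρA a)
    rw [LinearMap.rTensor_comp]
    rfl
  have hθζ : ∀ t, θ (ζ t) = t := fun t => by
    induction t with
    | zero => simp
    | add x y hx hy => rw [map_add, map_add, hx, hy]
    | tmul b c =>
      have h1 : ζ (b ⊗ₜ c) = b • l.1.ofConv c := by simp [ζ, Subalgebra.smul_def]
      have h2 : θ (l.1.ofConv c) = 1 ⊗ₜ c := by
        change p.rTensor C (ρA.coact (l.1.ofConv c)) = _
        rw [hl, ← LinearMap.comp_apply, ← LinearMap.rTensor_comp,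
          show p ∘ₗ l.1.ofConv = Algebra.linearMap R ρA.base ∘ₗ Coalgebra.counit from
            LinearMap.ext hpl, LinearMap.rTensor_comp, LinearMap.comp_apply,
          Coalgebra.rTensor_counit_comul]
        simp
      rw [h1, map_smul, h2, TensorProduct.smul_tmul', smul_eq_mul, mul_one]
  refine ⟨{ θ with invFun := ζ, left_inv := hζθ, right_inv := hθζ }, fun a => ?_⟩
  -- Colinearity of `θ` is the coassociativity of `ϱ_A` with `p` applied to the first leg.
  change (TensorProduct.assoc R ρA.base C C).symm (Coalgebra.comul.lTensor ρA.base
    (p.rTensor C (ρA.coact a))) = (p.rTensor C ∘ₗ ρA.coact).rTensor C (ρA.coact a)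
  rw [LinearEquiv.symm_apply_eq, LinearMap.rTensor_comp, LinearMap.comp_apply,
    ← LinearMap.comp_apply (LinearMap.lTensor _ _), LinearMap.lTensor_comp_rTensor,
    ← LinearMap.rTensor_comp_lTensor, LinearMap.comp_apply, ← ρA.coassoc]
  generalize ρA.coact.rTensor C (ρA.coact a) = u
  induction u with
  | zero => simp
  | add x y hx hy => simp only [map_add, hx, hy]
  | tmul x c =>
    induction x with
    | zero => simp
    | add x y hx hy => simp only [TensorProduct.add_tmul, map_add, hx, hy]
    | tmul a c' => simp

theorem IsCleft.exists_unit (h : ρA.IsCleft) : ∃ l : (WithConv (C →ₗ[R] A))ˣ,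
    IsColinear Coalgebra.comul ρA.coact l.1.ofConv := by
  obtain ⟨_, hl, l, rfl⟩ := h
  exact ⟨l, hl⟩

end Integral

end EntwinedModule

/-! ### The entwined module `A ⊗ C` -/

section Coring

variable {R : Type uR} {A : Type uA} {C : Type uC} [CommRing R] [Ring A]
    [Algebra R A] [AddCommGroup C] [Module R C]

theorem rightMul_add {M : Type*} [AddCommGroup M] [Module R M] [Module Aᵐᵒᵖ M]
    [IsScalarTower R Aᵐᵒᵖ M] (ψ : C ⊗[R] A →ₗ[R] A ⊗[R] C) (a b : A) :
    rightMul ψ M (a + b) = rightMul ψ M a + rightMul ψ M b := by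
  ext; simp [TensorProduct.tmul_add]

theorem rightMul_smul {M : Type*} [AddCommGroup M] [Module R M] [Module Aᵐᵒᵖ M]
    [IsScalarTower R Aᵐᵒᵖ M] (ψ : C ⊗[R] A →ₗ[R] A ⊗[R] C) (r : R) (a : A) :
    rightMul ψ M (r • a) = r • rightMul ψ M a := by
  ext; simp

variable [Coalgebra R C]

theorem Entwining.rightMul_mul (E : Entwining R A C) (a b : A) (t : A ⊗[R] C) :
    rightMul E.psi A (a * b) t = rightMul E.psi A b (rightMul E.psi A a t) := by
  induction t with
  | zero => simp
  | add x y hx hy => simp only [map_add, hx, hy]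
  | tmul x c =>
    rw [Entwining.rightMul_tmul, Entwining.rightMul_tmul, E.psi_mul,
      Entwining.rightMul_rTensor _ (actR R A A x) (fun m a => by simp [mul_assoc])]

/-- The right `A`-module structure `(x ⊗ c) · a = ∑ x a_ψ ⊗ c^ψ` of `A ⊗ C`. -/
def Entwining.rightMulHom (E : Entwining R A C) : Aᵐᵒᵖ →+* Module.End R (A ⊗[R] C) where
  toFun a := rightMul E.psi A (unop a)
  map_one' := by ext; simp [E.psi_one]
  map_mul' a b := LinearMap.ext fun t => E.rightMul_mul (unop b) (unop a) t
  map_zero' := by ext; simp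
  map_add' a b := rightMul_add E.psi (unop a) (unop b)

/-- The `R`-module `A ⊗ C`, in a larger universe. -/
def CoringModule (_E : Entwining R A C) : Type (max uA uC w) := ULift.{w} (A ⊗[R] C)

namespace CoringModule

variable (E : Entwining R A C)

instance : AddCommGroup (CoringModule.{uR, uA, uC, w} E) :=
  inferInstanceAs (AddCommGroup (ULift (A ⊗[R] C)))

instance : Module R (CoringModule.{uR, uA, uC, w} E) :=
  inferInstanceAs (Module R (ULift (A ⊗[R] C)))

/-- The identification with `A ⊗ C`. -/
def equiv : CoringModule.{uR, uA, uC, w} E ≃ₗ[R] A ⊗[R] C := ULift.moduleEquiv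

instance : Module Aᵐᵒᵖ (CoringModule.{uR, uA, uC, w} E) :=
  Module.compHom _ ((equiv E).symm.conjRingEquiv.toRingHom.comp E.rightMulHom)

theorem equiv_op_smul (a : A) (t : CoringModule.{uR, uA, uC, w} E) :
    equiv E (op a • t) = rightMul E.psi A a (equiv E t) :=
  (equiv.{uR, uA, uC, w} E).apply_symm_apply (rightMul E.psi A a (equiv E t))

theorem op_smul_symm (a : A) (t : A ⊗[R] C) :
    op a • (equiv E).symm t = (equiv.{uR, uA, uC, w} E).symm (rightMul E.psi A a t) := by
  rw [LinearEquiv.eq_symm_apply, equiv_op_smul, LinearEquiv.apply_symm_apply]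

instance : IsScalarTower R Aᵐᵒᵖ (CoringModule.{uR, uA, uC, w} E) where
  smul_assoc r a t := (equiv E).injective <| by
    obtain ⟨a, rfl⟩ := op_surjective a
    rw [← op_smul, equiv_op_smul, rightMul_smul, map_smul, equiv_op_smul, LinearMap.smul_apply]

/-- The compatibility of `id ⊗ Δ` with the right action. On `x ⊗ c` it is the axiom `psi_comul`; the
rest expands the iterated `ψ` on pure tensors. -/
theorem lTensor_comul_rightMul (a : A) (t : A ⊗[R] C) :
    (equiv.{uR, uA, uC, w} E).symm.toLinearMap.rTensor C ((TensorProduct.assoc R A C C).symm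
        (Coalgebra.comul.lTensor A (rightMul E.psi A a t))) =
      rightMul E.psi _ a ((equiv E).symm.toLinearMap.rTensor C
        ((TensorProduct.assoc R A C C).symm (Coalgebra.comul.lTensor A t))) := by
  induction t with
  | zero => simp
  | add x y hx hy => simp only [map_add, hx, hy]
  | tmul x c =>
    rw [Entwining.rightMul_tmul, ← LinearMap.comp_apply (LinearMap.lTensor _ _),
      LinearMap.lTensor_comp_rTensor, ← LinearMap.rTensor_comp_lTensor, LinearMap.comp_apply,
      E.psi_comul, LinearMap.lTensor_tmul]
    generalize (Coalgebra.comul c : C ⊗[R] C) = v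
    induction v with
    | zero => simp
    | add x y hx hy => simp only [TensorProduct.tmul_add, TensorProduct.add_tmul, map_add, hx, hy]
    | tmul u v =>
      simp only [TensorProduct.assoc_tmul, LinearMap.lTensor_tmul,
        TensorProduct.assoc_symm_tmul, LinearMap.rTensor_tmul, Entwining.rightMul_tmul,
        LinearEquiv.coe_coe]
      generalize E.psi (v ⊗ₜ a) = w
      induction w with
      | zero => simp
      | add x y hx hy => simp only [TensorProduct.tmul_add, map_add, hx, hy]
      | tmul b v =>
        simp only [TensorProduct.assoc_symm_tmul, LinearMap.rTensor_tmul, actR_apply, op_smul_symm,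
          Entwining.rightMul_tmul]
        generalize E.psi (u ⊗ₜ b) = w
        induction w with
        | zero => simp
        | add x y hx hy => simp only [TensorProduct.add_tmul, map_add, hx, hy]
        | tmul b v => simp

/-- The coaction `id ⊗ Δ` of `A ⊗ C`. -/
def coaction : CoringModule.{uR, uA, uC, w} E →ₗ[R] CoringModule.{uR, uA, uC, w} E ⊗[R] C :=
  (equiv E).symm.toLinearMap.rTensor C ∘ₗ (TensorProduct.assoc R A C C).symm.toLinearMap ∘ₗ
    Coalgebra.comul.lTensor A ∘ₗ (equiv E).toLinearMap

theorem coaction_symm (t : A ⊗[R] C) : coaction.{uR, uA, uC, w} E ((equiv E).symm t) =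
    (equiv E).symm.toLinearMap.rTensor C ((TensorProduct.assoc R A C C).symm
      (Coalgebra.comul.lTensor A t)) := by
  simp [coaction]

/-- The map `C → A ⊗ C, c ↦ a ⊗ c`. -/
def ofTmul (a : A) : C →ₗ[R] CoringModule.{uR, uA, uC, w} E :=
  (equiv E).symm.toLinearMap ∘ₗ TensorProduct.mk R A C a

/-- The images of these colinear maps generate `A ⊗ C` additively, so the comodule axioms for `A ⊗
C` follow from those of `C`. -/
theorem isColinear_ofTmul (a : A) :
    IsColinear Coalgebra.comul (coaction E) (ofTmul.{uR, uA, uC, w} E a) := by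
  intro c
  rw [ofTmul, LinearMap.comp_apply, TensorProduct.mk_apply, LinearEquiv.coe_coe, coaction_symm,
    LinearMap.lTensor_tmul]
  generalize (Coalgebra.comul c : C ⊗[R] C) = v
  induction v with
  | zero => simp
  | add x y hx hy => simp only [TensorProduct.tmul_add, map_add, hx, hy]
  | tmul u v => simp

variable {E} in
theorem induction_ofTmul {P : CoringModule.{uR, uA, uC, w} E → Prop} (h0 : P 0)
    (h : ∀ a c, P (ofTmul E a c)) (hadd : ∀ x y, P x → P y → P (x + y))
    (m : CoringModule.{uR, uA, uC, w} E) : P m := by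
  obtain ⟨t, rfl⟩ := (equiv E).symm.surjective m
  induction t with
  | zero => simpa
  | add x y hx hy => simpa using hadd _ _ hx hy
  | tmul a c => exact h a c

/-- The entwined module `A ⊗ C`, with the coaction `id ⊗ Δ`. -/
def entwined : EntwinedModule E (CoringModule.{uR, uA, uC, w} E) where
  coact := coaction E
  coassoc m := by
    induction m using induction_ofTmul with
    | h0 => simp
    | hadd x y hx hy => simp only [map_add, hx, hy]
    | h a c =>
      have h1 : coaction E ∘ₗ ofTmul E a = (ofTmul.{uR, uA, uC, w} E a).rTensor C ∘ₗ
          Coalgebra.comul := LinearMap.ext (isColinear_ofTmul E a)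
      rw [isColinear_ofTmul, ← LinearMap.comp_apply (LinearMap.rTensor _ _),
        ← LinearMap.rTensor_comp, h1, LinearMap.rTensor_comp, LinearMap.comp_apply,
        ← LinearMap.comp_apply (LinearMap.lTensor _ _), LinearMap.lTensor_comp_rTensor,
        ← LinearMap.rTensor_comp_lTensor, LinearMap.comp_apply, ← Coalgebra.coassoc_apply,
        LinearMap.rTensor_tensor]
      simp
  counit m := by
    induction m using induction_ofTmul with
    | h0 => simp
    | hadd x y hx hy => simp only [map_add, hx, hy]
    | h a c =>
      rw [isColinear_ofTmul, ← LinearMap.comp_apply (LinearMap.lTensor _ _),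
        LinearMap.lTensor_comp_rTensor, ← LinearMap.rTensor_comp_lTensor, LinearMap.comp_apply,
        Coalgebra.lTensor_counit_comul]
      simp
  coact_smul m a := by
    simp only [coaction, LinearMap.comp_apply, LinearEquiv.coe_coe, equiv_op_smul,
      lTensor_comul_rightMul]

variable {E} (ρA : EntwinedModule E A)

/-- The right action on `A ⊗ C` commutes with left multiplication by `A`, and `ϱ(1) · x = ϱ(x)`.
This is what turns `Ψ` into `β`. -/
theorem rightMul_smul_grouplike (a x : A) :
    rightMul E.psi A x (a • ρA.grouplike) = a • ρA.coact x := by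
  rw [EntwinedModule.smul_eq_rTensor_actR, EntwinedModule.smul_eq_rTensor_actR,
    Entwining.rightMul_rTensor _ _ (fun m a => by simp [mul_assoc]), EntwinedModule.coact_eq]

/-- Coinvariance of `a ϱ(1)` amounts to `a 1₀ ⊗ Δ(1₁) = a ϱ(1₀) ⊗ 1₁`, which is coassociativity at
`1`. -/
theorem smul_grouplike_mem_coinv (a : A) :
    (equiv.{uR, uA, uC, w} E).symm (a • ρA.grouplike) ∈
      EntwinedModule.coinv ρA (entwined E) := by
  have h : actR R A _ ((equiv.{uR, uA, uC, w} E).symm (a • ρA.grouplike)) =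
      (equiv E).symm.toLinearMap ∘ₗ (actR R A A a).rTensor C ∘ₗ ρA.coact := by
    ext x
    rw [actR_apply, op_smul_symm, rightMul_smul_grouplike, EntwinedModule.smul_eq_rTensor_actR]
    rfl
  rw [EntwinedModule.mem_coinv, h]
  refine (coaction_symm E _).trans ?_
  rw [EntwinedModule.smul_eq_rTensor_actR, ← LinearMap.comp_apply (LinearMap.lTensor _ _),
    LinearMap.lTensor_comp_rTensor, ← LinearMap.rTensor_comp_lTensor, LinearMap.comp_apply,
    EntwinedModule.grouplike, ← ρA.coassoc, LinearMap.rTensor_tensor]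
  simp [LinearMap.rTensor_comp]

/-- By `psi_counit`, the map `id ⊗ ε : A ⊗ C → A` is right `A`-linear. -/
theorem counit_rightMul (a : A) (t : A ⊗[R] C) :
    TensorProduct.rid R A (Coalgebra.counit.lTensor A (rightMul E.psi A a t)) =
      TensorProduct.rid R A (Coalgebra.counit.lTensor A t) * a := by
  induction t with
  | zero => simp
  | add x y hx hy => simp only [map_add, hx, hy, add_mul]
  | tmul x c =>
    have h : ∀ u : A ⊗[R] R, TensorProduct.rid R A ((actR R A A x).rTensor R u) =
        x * TensorProduct.rid R A u := fun u => by
      induction u with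
      | zero => simp
      | add x y hx hy => simp only [map_add, hx, hy, mul_add]
      | tmul x c => simp
    rw [Entwining.rightMul_tmul, ← LinearMap.comp_apply (LinearMap.lTensor _ _),
      LinearMap.lTensor_comp_rTensor, ← LinearMap.rTensor_comp_lTensor, LinearMap.comp_apply,
      h, E.psi_counit]
    simp

/-- Apply `(id ⊗ ε) ⊗ id` to the coinvariance equation of `t`: the left side collapses to `t` by the
counit law, the right side to `(id ⊗ ε)(t) · ϱ(1)` by right linearity of `id ⊗ ε`. -/
theorem eq_smul_grouplike_of_mem_coinv {t : A ⊗[R] C}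
    (h : (equiv.{uR, uA, uC, w} E).symm t ∈ EntwinedModule.coinv ρA (entwined E)) :
    t = TensorProduct.rid R A (Coalgebra.counit.lTensor A t) • ρA.grouplike := by
  let G : CoringModule.{uR, uA, uC, w} E →ₗ[R] A :=
    (TensorProduct.rid R A).toLinearMap ∘ₗ Coalgebra.counit.lTensor A ∘ₗ (equiv E).toLinearMap
  have h1 : G ∘ₗ actR R A _ ((equiv.{uR, uA, uC, w} E).symm t) =
      actR R A A (TensorProduct.rid R A (Coalgebra.counit.lTensor A t)) := by
    ext x
    simp [G, equiv_op_smul, counit_rightMul]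
  have h2 : ∀ t, G.rTensor C (coaction E ((equiv.{uR, uA, uC, w} E).symm t)) = t := by
    intro t
    induction t with
    | zero => simp
    | add x y hx hy => simp only [map_add, hx, hy]
    | tmul x c =>
      have hG : G ∘ₗ ofTmul E x = LinearMap.toSpanSingleton R A x ∘ₗ Coalgebra.counit := by
        ext; simp [G, ofTmul]
      change G.rTensor C (coaction E (ofTmul E x c)) = _
      rw [isColinear_ofTmul, ← LinearMap.comp_apply, ← LinearMap.rTensor_comp, hG,
        LinearMap.rTensor_comp, LinearMap.comp_apply, Coalgebra.rTensor_counit_comul]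
      simp
  rw [EntwinedModule.mem_coinv] at h
  replace h := congrArg (G.rTensor C) h
  rw [← LinearMap.rTensor_comp_apply, h1] at h
  rw [EntwinedModule.smul_eq_rTensor_actR, ← h]
  exact (h2 t).symm

end CoringModule

end Coring

/-! ### Functoriality of the balanced tensor product -/

namespace BalancedTensor

variable {R S N N' L : Type*} [CommRing R] [Ring S] [AddCommGroup N] [Module R N]
  [Module Sᵐᵒᵖ N] [AddCommGroup N'] [Module R N'] [Module Sᵐᵒᵖ N'] [AddCommGroup L] [Module R L]
  [Module S L]

variable (L) in
/-- The map `f ⊗_S L`, for a right `S`-linear map `f`. -/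
def map (f : N →ₗ[R] N') (hf : ∀ n (s : S), f (op s • n) = op s • f n) :
    BalancedTensor R S N L →ₗ[R] BalancedTensor R S N' L :=
  lift (mk R S N' L ∘ₗ f) fun n s l => by simp [hf, smul_tmul]

@[simp] theorem map_tmul (f : N →ₗ[R] N') (hf : ∀ n (s : S), f (op s • n) = op s • f n)
    (n : N) (l : L) : map L f hf (tmul R S n l) = tmul R S (f n) l :=
  lift_tmul _ _ n l

theorem map_bijective (f : N →ₗ[R] N') (hf : ∀ n (s : S), f (op s • n) = op s • f n)
    (h : Function.Bijective f) : Function.Bijective (map L f hf) := by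
  let e := LinearEquiv.ofBijective f h
  have he : ∀ n (s : S), e.symm (op s • n) = op s • e.symm n := fun n s => by
    rw [LinearEquiv.symm_apply_eq, LinearEquiv.ofBijective_apply, hf,
      show f (e.symm n) = n from e.apply_symm_apply n]
  refine Function.bijective_iff_has_inverse.2 ⟨map L e.symm.toLinearMap he, fun t => ?_,
    fun t => ?_⟩
  · suffices map L e.symm.toLinearMap he ∘ₗ map L f hf = LinearMap.id from
      LinearMap.congr_fun this t
    refine hom_ext fun n l => ?_
    simp [show e.symm (f n) = n from e.symm_apply_apply n]
  · suffices map L f hf ∘ₗ map L e.symm.toLinearMap he = LinearMap.id from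
      LinearMap.congr_fun this t
    refine hom_ext fun n l => ?_
    simp [show f (e.symm n) = n from e.apply_symm_apply n]

end BalancedTensor

namespace SmashOp

variable {R : Type uR} {A : Type uA} {C : Type uC} [CommRing R] [Ring A]
    [Algebra R A] [AddCommGroup C] [Module R C]

theorem eval_smul (g : C →ₗ[R] A) (a : A) (t : A ⊗[R] C) :
    eval g (a • t) = a * eval g t := by
  induction t with
  | zero => simp
  | add x y hx hy => simp only [smul_add, map_add, mul_add, hx, hy]
  | tmul x c => simp [TensorProduct.smul_tmul', mul_assoc]

variable [Coalgebra R C] {E : Entwining R A C}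

variable (E) in
/-- The element of `#_ψ^op(C, A)` given by a linear map. -/
def ofLin (g : C →ₗ[R] A) : SmashOp E := g

theorem ofLin_injective : Function.Injective (ofLin E) := fun _ _ h => h

theorem Lambda_apply (ρA : EntwinedModule E A) (g : SmashOp E) (a : A) :
    unop (Lambda ρA g) a = eval (toLin g) (ρA.coact a) := rfl

end SmashOp

/-! ### The Galois map, `Λ`, and the return to cleftness -/

namespace EntwinedModule

variable {R : Type uR} {A : Type uA} {C : Type uC} [CommRing R] [Ring A]
    [Algebra R A] [AddCommGroup C] [Module R C] [Coalgebra R C] {E : Entwining R A C}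
    (ρA : EntwinedModule E A)

theorem galoisMap_tmul (x a : A) :
    galoisMap ρA (BalancedTensor.tmul R ρA.base x a) = x • ρA.coact a := by
  refine (BalancedTensor.lift_tmul _ _ x a).trans ?_
  have h : LinearMap.mul R A x = actR R A A x := by ext; simp
  simp [smul_eq_rTensor_actR, h]

/-- The map `A → (A ⊗ C)^{co 𝒞}, a ↦ ∑ a 1₀ ⊗ 1₁`. -/
def toCoringCoinv : A →ₗ[R] coinv ρA (CoringModule.entwined.{uR, uA, uC, w} E) :=
  LinearMap.codRestrict _ ((CoringModule.equiv E).symm.toLinearMap ∘ₗ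
    LinearMap.flip (Algebra.lsmul R R (A ⊗[R] C)).toLinearMap ρA.grouplike)
    (CoringModule.smul_grouplike_mem_coinv ρA)

theorem coe_toCoringCoinv (a : A) : (toCoringCoinv.{uR, uA, uC, w} ρA a : CoringModule E) =
    (CoringModule.equiv E).symm (a • ρA.grouplike) := rfl

theorem counit_grouplike :
    TensorProduct.rid R A (Coalgebra.counit.lTensor A ρA.grouplike) = 1 :=
  ρA.counit 1

/-- The inverse is `id ⊗ ε`, since `(id ⊗ ε)(ϱ(1)) = 1` and every coinvariant is a multiple of
`ϱ(1)`. -/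
theorem toCoringCoinv_bijective : Function.Bijective (toCoringCoinv.{uR, uA, uC, w} ρA) := by
  constructor
  · intro a b h
    have h1 := (CoringModule.equiv E).symm.injective (congrArg Subtype.val h)
    have h2 : ∀ a, TensorProduct.rid R A (Coalgebra.counit.lTensor A (a • ρA.grouplike)) = a := by
      intro a
      refine Eq.trans ?_ (congrArg (a * ·) ρA.counit_grouplike |>.trans (mul_one a))
      generalize ρA.grouplike = u
      induction u with
      | zero => simp
      | add x y hx hy => simp only [smul_add, map_add, hx, hy, mul_add]
      | tmul x c => simp [TensorProduct.smul_tmul']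
    rw [← h2 a, ← h2 b]
    exact congrArg _ (congrArg _ h1)
  · rintro ⟨m, hm⟩
    obtain ⟨t, rfl⟩ := (CoringModule.equiv E).symm.surjective m
    exact ⟨_, Subtype.ext (congrArg (CoringModule.equiv E).symm
      (CoringModule.eq_smul_grouplike_of_mem_coinv ρA hm).symm)⟩

/-- For `b` in `B`, `ϱ(1) · b = ϱ(b) = b ϱ(1)`. -/
theorem toCoringCoinv_op_smul (a : A) (b : ρA.base) :
    toCoringCoinv.{uR, uA, uC, w} ρA (op b • a) = op b • toCoringCoinv ρA a := by
  apply Subtype.ext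
  rw [coe_op_smul, coe_toCoringCoinv, coe_toCoringCoinv, CoringModule.op_smul_symm,
    CoringModule.rightMul_smul_grouplike, (mem_coinv ρA ρA b).1 b.2, ← smul_eq_rTensor_actR,
    smul_smul]
  rfl

/-- `β` is `Ψ` for the entwined module `A ⊗ C`. -/
theorem isGaloisExt_of_counitMap_bijective
    (h : Function.Bijective (counitMap ρA (CoringModule.entwined.{uR, uA, uC, w} E))) :
    ρA.IsGaloisExt := by
  have h1 : galoisMap ρA = (CoringModule.equiv E).toLinearMap ∘ₗ
      counitMap ρA (CoringModule.entwined.{uR, uA, uC, w} E) ∘ₗ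
        BalancedTensor.map A (toCoringCoinv ρA) (toCoringCoinv_op_smul ρA) := by
    refine BalancedTensor.hom_ext fun x a => ?_
    rw [LinearMap.comp_apply, LinearMap.comp_apply, BalancedTensor.map_tmul, counitMap_tmul,
      galoisMap_tmul, coe_toCoringCoinv, LinearEquiv.coe_coe, CoringModule.equiv_op_smul,
      LinearEquiv.apply_symm_apply, CoringModule.rightMul_smul_grouplike]
  rw [IsGaloisExt, h1]
  exact (CoringModule.equiv E).bijective.comp
    (h.comp (BalancedTensor.map_bijective _ _ (toCoringCoinv_bijective ρA)))

theorem WeakStructureTheorem.isGaloisExt (h : WeakStructureTheorem.{uR, uA, uC, w} ρA) :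
    ρA.IsGaloisExt :=
  isGaloisExt_of_counitMap_bijective.{uR, uA, uC, w} ρA (h _ _)

/-- `Λ` is the `A`-linear dual of `β`. -/
theorem IsGaloisExt.lambda_bijective (h : ρA.IsGaloisExt) :
    Function.Bijective (SmashOp.Lambda ρA) := by
  constructor
  · intro g g' hg
    -- Evaluating `g` on `β(x ⊗ a) = x ϱ(a)` gives `x Λ(g)(a)`, so `Λ(g)` determines `g` on the
    -- image of `β`, which contains all `1 ⊗ c`.
    have h1 : SmashOp.eval (SmashOp.toLin g) ∘ₗ galoisMap ρA =
        SmashOp.eval (SmashOp.toLin g') ∘ₗ galoisMap ρA := by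
      refine BalancedTensor.hom_ext fun x a => ?_
      rw [LinearMap.comp_apply, LinearMap.comp_apply, galoisMap_tmul, SmashOp.eval_smul, SmashOp.eval_smul,
        ← SmashOp.Lambda_apply, ← SmashOp.Lambda_apply, hg]
    apply SmashOp.toLin_injective
    ext c
    obtain ⟨t, ht⟩ := h.2 ((1 : A) ⊗ₜ c)
    simpa [ht] using LinearMap.congr_fun h1 t
  · intro f
    obtain ⟨f, rfl⟩ := op_surjective f
    let e := LinearEquiv.ofBijective (galoisMap ρA) h
    -- `F` is the left `A`-linear extension `x ⊗ a ↦ x f(a)` of `f`, and `L x` is left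
    -- multiplication by `x` on `A ⊗_B A`. Both `F` and `β` are compatible with `L`.
    let F : BalancedTensor R ρA.base A A →ₗ[R] A :=
      BalancedTensor.lift ((LinearMap.mul R A).compl₂ (f.restrictScalars R)) fun x b a => by
        simpa [mul_assoc, Subalgebra.smul_def] using
          congrArg (x * ·) (f.map_smul b a).symm
    let L : A → BalancedTensor R ρA.base A A →ₗ[R] BalancedTensor R ρA.base A A := fun x =>
      BalancedTensor.map A (LinearMap.mulLeft R x) fun n s => by simp [mul_assoc]
    have hL : ∀ x y a, L x (BalancedTensor.tmul R ρA.base y a) =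
        BalancedTensor.tmul R ρA.base (x * y) a := fun x y a => BalancedTensor.map_tmul _ _ y a
    have hFL : ∀ x t, F (L x t) = x * F t := fun x t => by
      suffices F ∘ₗ L x = LinearMap.mulLeft R x ∘ₗ F from LinearMap.congr_fun this t
      refine BalancedTensor.hom_ext fun y a => ?_
      simp [F, hL, mul_assoc]
    have hβL : ∀ x t, galoisMap ρA (L x t) = x • galoisMap ρA t := fun x t => by
      suffices galoisMap ρA ∘ₗ L x = (Algebra.lsmul R R (A ⊗[R] C) x) ∘ₗ galoisMap ρA from
        LinearMap.congr_fun this t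
      refine BalancedTensor.hom_ext fun y a => ?_
      simp [hL, galoisMap_tmul, mul_smul]
    -- The preimage is forced: `g(c) = F(β⁻¹(1 ⊗ c))`, and left linearity extends this to `a g(c) =
    -- F(β⁻¹(a ⊗ c))`.
    let g : C →ₗ[R] A := F ∘ₗ e.symm.toLinearMap ∘ₗ TensorProduct.mk R A C 1
    have hg : ∀ t, SmashOp.eval g (galoisMap ρA t) = F t := fun t => by
      have : ∀ u, SmashOp.eval g u = F (e.symm u) := fun u => by
        induction u with
        | zero => simp
        | add x y hx hy => simp only [map_add, hx, hy]
        | tmul x c =>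
          have : e.symm (x ⊗ₜ c) = L x (e.symm (1 ⊗ₜ c)) := by
            rw [LinearEquiv.symm_apply_eq, show ∀ t, e t = galoisMap ρA t from fun _ => rfl, hβL,
              show galoisMap ρA (e.symm (1 ⊗ₜ c)) = 1 ⊗ₜ c from e.apply_symm_apply _,
              TensorProduct.smul_tmul', smul_eq_mul, mul_one]
          rw [this, hFL]
          simp [g]
      rw [this]
      exact congrArg F (e.symm_apply_apply t)
    refine ⟨SmashOp.ofLin E g, unop_injective <| LinearMap.ext fun a => ?_⟩
    have := hg (BalancedTensor.tmul R ρA.base 1 a)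
    rw [galoisMap_tmul, one_smul] at this
    refine this.trans ?_
    simp [F]

/-- With the right normal basis property, bijectivity of `Λ` implies cleftness. -/
theorem isCleft_of_lambda_bijective (h : Function.Bijective (SmashOp.Lambda ρA))
    (hA : ρA.NormalBasis) : ρA.IsCleft := by
  obtain ⟨θ, hθ⟩ := hA
  let l : C →ₗ[R] A := θ.symm.toLinearMap.restrictScalars R ∘ₗ TensorProduct.mk R ρA.base C 1
  have hl : IsColinear Coalgebra.comul ρA.coact l := by
    intro c
    -- Colinearity of `λ` can be tested after applying `θ ⊗ C`, where it becomes that of `c ↦ 1 ⊗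
    -- c`.
    have h1 : Function.Injective ((θ.toLinearMap.restrictScalars R).rTensor C) :=
      (LinearEquiv.rTensor C (θ.restrictScalars R)).injective
    have hθl : θ.toLinearMap.restrictScalars R ∘ₗ l = TensorProduct.mk R ρA.base C 1 := by
      ext c; simp [l]
    apply h1
    rw [← hθ, ← LinearMap.rTensor_comp_apply, ← LinearMap.comp_apply _ l, hθl]
    simp only [LinearMap.comp_apply, TensorProduct.mk_apply, LinearMap.lTensor_tmul]
    generalize (Coalgebra.comul c : C ⊗[R] C) = v
    induction v with
    | zero => simp
    | add x y hx hy => simp only [TensorProduct.tmul_add, map_add, hx, hy]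
    | tmul u v => simp
  have hmul : ∀ g : WithConv (C →ₗ[R] A), ∀ c, (WithConv.toConv l * g).ofConv c =
      unop (SmashOp.Lambda ρA (SmashOp.ofLin E g.ofConv)) (l c) := fun g c => by
    rw [SmashOp.Lambda_apply, hl, ← actBy_rTensor_comul, actBy_self]
    rfl
  -- Since `θ⁻¹(b ⊗ c) = b λ(c)`, the image of `λ` generates `A` over `B`.
  have hext : ∀ f f' : Module.End ρA.base A, (∀ c, f (l c) = f' (l c)) → f = f' := by
    intro f f' hf
    ext a
    obtain ⟨t, rfl⟩ := θ.symm.surjective a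
    induction t with
    | zero => simp
    | add x y hx hy => simp only [map_add, hx, hy]
    | tmul b c =>
      have : θ.symm (b ⊗ₜ c) = b • l c := by
        rw [LinearEquiv.symm_apply_eq, map_smul]
        simp [l, TensorProduct.smul_tmul']
      rw [this, map_smul, map_smul, hf]
  have hinj : ∀ g g' : WithConv (C →ₗ[R] A),
      WithConv.toConv l * g = WithConv.toConv l * g' → g = g' := by
    intro g g' hg
    have : SmashOp.ofLin E g.ofConv = SmashOp.ofLin E g'.ofConv := by
      apply h.1
      apply unop_injective
      apply hext
      intro c
      rw [← hmul, ← hmul, hg]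
    exact WithConv.ofConv_injective (SmashOp.ofLin_injective this)
  obtain ⟨m, hm⟩ : ∃ m : WithConv (C →ₗ[R] A), WithConv.toConv l * m = 1 := by
    -- `f` is the `B`-linear map with `f(b λ(c)) = ε(c) b`. If `Λ(g) = f`, then `(λ ⋆ g)(c) =
    -- f(λ(c)) = ε(c)`.
    let f : Module.End ρA.base A :=
      (TensorProduct.AlgebraTensorModule.lift
        (LinearMap.toSpanSingleton ρA.base (C →ₗ[R] A)
          (Algebra.linearMap R A ∘ₗ Coalgebra.counit))) ∘ₗ θ.toLinearMap
    obtain ⟨g, hg⟩ := h.2 (op f)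
    refine ⟨WithConv.toConv (SmashOp.toLin g), WithConv.ofConv_injective <| LinearMap.ext fun c => ?_⟩
    rw [hmul]
    refine (LinearMap.congr_fun (congrArg unop hg) (l c)).trans ?_
    simp [f, l]
  refine ⟨WithConv.toConv l, hl, isUnit_iff_exists.2 ⟨m, hm, ?_⟩⟩
  -- The right inverse is two-sided by cancellation: `λ ⋆ (m ⋆ λ) = λ = λ ⋆ 1`.
  apply hinj
  rw [← mul_assoc, hm, one_mul, mul_one]

end EntwinedModule

/-! ### The strong structure theorem -/

namespace EntwinedModule

variable {R : Type uR} {A : Type uA} {C : Type uC} [CommRing R] [Ring A]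
    [Algebra R A] [AddCommGroup C] [Module R C]

/-! ### Tensoring with `A ≃ B ⊗ C` -/

section Free

variable {B : Type*} [Ring B] [Algebra R B] [Module B A] [IsScalarTower R B A]
  {N : Type*} [AddCommGroup N] [Module R N] [Module Bᵐᵒᵖ N] [IsScalarTower R Bᵐᵒᵖ N]
  {N' : Type*} [AddCommGroup N'] [Module R N'] [Module Bᵐᵒᵖ N'] [IsScalarTower R Bᵐᵒᵖ N']

/-- The map `N ⊗_B A → N ⊗ C` induced by a left `B`-linear isomorphism `A ≃ B ⊗ C`. -/
def toTensor (θ : A ≃ₗ[B] B ⊗[R] C) (N : Type*) [AddCommGroup N] [Module R N] [Module Bᵐᵒᵖ N]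
    [IsScalarTower R Bᵐᵒᵖ N] : BalancedTensor R B N A →ₗ[R] N ⊗[R] C :=
  BalancedTensor.lift
    ((LinearMap.rTensorHom C ∘ₗ actR R B N).compl₂ (θ.toLinearMap.restrictScalars R)) <| by
    intro n b a
    simp only [LinearMap.compl₂_apply, LinearMap.comp_apply, LinearMap.coe_rTensorHom,
      LinearMap.restrictScalars_apply, LinearEquiv.coe_coe, map_smul]
    generalize θ a = u
    induction u with
    | zero => simp
    | add x y hx hy => simp only [smul_add, map_add, hx, hy]
    | tmul x c => simp [TensorProduct.smul_tmul', mul_smul]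

theorem toTensor_tmul (θ : A ≃ₗ[B] B ⊗[R] C) (n : N) (a : A) :
    toTensor θ N (BalancedTensor.tmul R B n a) = (actR R B N n).rTensor C (θ a) :=
  BalancedTensor.lift_tmul _ _ n a

/-- This is `N ⊗_B (B ⊗ C) ≃ N ⊗ C`; the inverse sends `n ⊗ c` to `n ⊗ θ⁻¹(1 ⊗ c)`. -/
theorem toTensor_bijective (θ : A ≃ₗ[B] B ⊗[R] C) : Function.Bijective (toTensor θ N) := by
  let T : N ⊗[R] C →ₗ[R] BalancedTensor R B N A := BalancedTensor.proj R B N A ∘ₗ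
    (θ.symm.toLinearMap.restrictScalars R ∘ₗ TensorProduct.mk R B C 1).lTensor N
  have hT : ∀ n c, T (n ⊗ₜ c) = BalancedTensor.tmul R B n (θ.symm (1 ⊗ₜ c)) := fun n c => rfl
  refine Function.bijective_iff_has_inverse.2 ⟨T, fun t => ?_, fun t => ?_⟩
  · suffices T ∘ₗ toTensor θ N = LinearMap.id from LinearMap.congr_fun this t
    refine BalancedTensor.hom_ext fun n a => ?_
    obtain ⟨u, rfl⟩ := θ.symm.surjective a
    rw [LinearMap.comp_apply, toTensor_tmul, LinearEquiv.apply_symm_apply, LinearMap.id_apply]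
    induction u with
    | zero => simp [BalancedTensor.tmul_zero]
    | add x y hx hy => simp only [map_add, hx, hy, BalancedTensor.tmul_add]
    | tmul b c =>
      rw [LinearMap.rTensor_tmul, hT, actR_apply, BalancedTensor.smul_tmul, ← map_smul,
        TensorProduct.smul_tmul', smul_eq_mul, mul_one]
  · induction t with
    | zero => simp
    | add x y hx hy => rw [map_add, map_add, hx, hy]
    | tmul n c => simp [hT, toTensor_tmul]

theorem toTensor_map (θ : A ≃ₗ[B] B ⊗[R] C) (f : N →ₗ[R] N')
    (hf : ∀ n (b : B), f (op b • n) = op b • f n) (t : BalancedTensor R B N A) :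
    toTensor θ N' (BalancedTensor.map A f hf t) = f.rTensor C (toTensor θ N t) := by
  suffices toTensor θ N' ∘ₗ BalancedTensor.map A f hf = f.rTensor C ∘ₗ toTensor θ N from
    LinearMap.congr_fun this t
  refine BalancedTensor.hom_ext fun n a => ?_
  have h : actR R B N' (f n) = f ∘ₗ actR R B N n := by ext; simp [hf]
  rw [LinearMap.comp_apply, BalancedTensor.map_tmul, toTensor_tmul, h, LinearMap.rTensor_comp,
    LinearMap.comp_apply, LinearMap.comp_apply, toTensor_tmul]

/-- If `A ≃ B ⊗ C` as left `B`-modules and `C` is faithfully flat over `R`, then `- ⊗_B A`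
reflects isomorphisms. -/
theorem bijective_of_map_bijective [Module.FaithfullyFlat R C] (θ : A ≃ₗ[B] B ⊗[R] C)
    (f : N →ₗ[R] N') (hf : ∀ n (b : B), f (op b • n) = op b • f n)
    (h : Function.Bijective (BalancedTensor.map A f hf)) : Function.Bijective f := by
  have h1 : f.rTensor C ∘ toTensor θ N = toTensor θ N' ∘ BalancedTensor.map A f hf :=
    funext fun t => (toTensor_map θ f hf t).symm
  have h2 : Function.Bijective (f.rTensor C) := by
    rw [← Function.Bijective.of_comp_iff _ (toTensor_bijective θ), h1]
    exact (toTensor_bijective θ).comp h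
  rw [← Module.FaithfullyFlat.lTensor_bijective_iff_bijective R C f]
  exact ⟨(LinearMap.lTensor_inj_iff_rTensor_inj C f).2 h2.1,
    (LinearMap.lTensor_surj_iff_rTensor_surj C f).2 h2.2⟩

end Free

/-! ### Bijectivity of the unit `Φ_N` -/

variable [Coalgebra R C] {E : Entwining R A C} (ρA : EntwinedModule E A)

instance {M : Type*} [AddCommGroup M] [Module R M] [Module Aᵐᵒᵖ M] [IsScalarTower R Aᵐᵒᵖ M]
    (ρM : EntwinedModule E M) : IsScalarTower R (↥ρA.base)ᵐᵒᵖ (coinv ρA ρM) where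
  smul_assoc r b m := Subtype.ext (smul_assoc r (op ((unop b : ρA.base) : A)) (m : M))

variable {N : Type*} [AddCommGroup N] [Module R N] [Module (↥ρA.base)ᵐᵒᵖ N]

theorem coe_unitMap (n : N) : (unitMap ρA N n : BalancedTensor R ρA.base N A) =
    BalancedTensor.tmul R ρA.base n 1 := rfl

theorem unitMap_op_smul (n : N) (b : ρA.base) :
    unitMap ρA N (op b • n) = op b • unitMap ρA N n := by
  apply Subtype.ext
  rw [coe_op_smul, coe_unitMap, coe_unitMap, BalancedTensor.smul_tmul,
    BalancedTensor.op_smul_tmul]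
  simp [Subalgebra.smul_def]

/-- A triangle identity of the adjunction between induction and coinvariants: `n ⊗ a ↦ (n ⊗ 1) ⊗ a ↦
n ⊗ a`. -/
theorem counitMap_map_unitMap (t : BalancedTensor R ρA.base N A) :
    counitMap ρA (induced ρA N)
      (BalancedTensor.map A (unitMap ρA N) (unitMap_op_smul ρA) t) = t := by
  suffices counitMap ρA (induced ρA N) ∘ₗ
      BalancedTensor.map A (unitMap ρA N) (unitMap_op_smul ρA) = LinearMap.id from
    LinearMap.congr_fun this t
  refine BalancedTensor.hom_ext fun n a => ?_
  rw [LinearMap.comp_apply, BalancedTensor.map_tmul, counitMap_tmul, coe_unitMap,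
    BalancedTensor.op_smul_tmul]
  simp

/-- By the triangle identity `Φ_N ⊗_B A` is a one-sided inverse of the bijection `Ψ` at `N ⊗_B A`,
hence bijective; faithful flatness then descends this to `Φ_N`. -/
theorem unitMap_bijective [IsScalarTower R (↥ρA.base)ᵐᵒᵖ N] [Module.FaithfullyFlat R C]
    (hA : ρA.NormalBasis) (h : Function.Bijective (counitMap ρA (induced ρA N))) :
    Function.Bijective (unitMap ρA N) := by
  obtain ⟨θ, -⟩ := hA
  refine bijective_of_map_bijective θ _ (unitMap_op_smul ρA) ?_
  rw [← Function.Bijective.of_comp_iff' h]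
  convert Function.bijective_id
  ext t
  exact counitMap_map_unitMap ρA t

variable {ρA}

theorem IsCleft.normalBasis (h : ρA.IsCleft) : ρA.NormalBasis :=
  h.exists_unit.elim fun _ hl => normalBasis_of_integral hl

theorem IsCleft.weakStructureTheorem (h : ρA.IsCleft) :
    WeakStructureTheorem.{uR, uA, uC, w} ρA := fun _ _ _ _ _ ρM =>
  h.exists_unit.elim fun _ hl => counitMap_bijective hl ρM

theorem IsCleft.strongStructureTheorem [Module.FaithfullyFlat R C] (h : ρA.IsCleft) :
    StrongStructureTheorem.{uR, uA, uC, w} ρA :=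
  ⟨h.weakStructureTheorem, fun _ _ _ _ _ => unitMap_bijective ρA h.normalBasis
    (h.exists_unit.elim fun _ hl => counitMap_bijective hl _)⟩

end EntwinedModule

end

/-! ### The equivalences -/

theorem mainTheorem1 {R : Type uR} {A : Type uA} {C : Type uC} [CommRing R] [Ring A]
    [Algebra R A] [AddCommGroup C] [Module R C] [Coalgebra R C]
    (E : Entwining R A C) (ρA : EntwinedModule E A) :
    List.TFAE
      [ρA.IsCleft,
       EntwinedModule.WeakStructureTheorem.{uR, uA, uC, w} ρA ∧ ρA.NormalBasis,
       ρA.IsGaloisExt ∧ ρA.NormalBasis,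
       Function.Bijective (SmashOp.Lambda ρA) ∧ ρA.NormalBasis] ∧
    (Module.FaithfullyFlat R C → List.TFAE
      [ρA.IsCleft,
       EntwinedModule.WeakStructureTheorem.{uR, uA, uC, w} ρA ∧ ρA.NormalBasis,
       ρA.IsGaloisExt ∧ ρA.NormalBasis,
       Function.Bijective (SmashOp.Lambda ρA) ∧ ρA.NormalBasis,
       EntwinedModule.StrongStructureTheorem.{uR, uA, uC, w} ρA ∧ ρA.NormalBasis]) := by
  have h12 (h : ρA.IsCleft) :
      EntwinedModule.WeakStructureTheorem.{uR, uA, uC, w} ρA ∧ ρA.NormalBasis :=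
    ⟨h.weakStructureTheorem, h.normalBasis⟩
  have h23 (h : EntwinedModule.WeakStructureTheorem.{uR, uA, uC, w} ρA ∧ ρA.NormalBasis) :
      ρA.IsGaloisExt ∧ ρA.NormalBasis :=
    ⟨h.1.isGaloisExt, h.2⟩
  have h34 (h : ρA.IsGaloisExt ∧ ρA.NormalBasis) :
      Function.Bijective (SmashOp.Lambda ρA) ∧ ρA.NormalBasis :=
    ⟨h.1.lambda_bijective, h.2⟩
  have h41 (h : Function.Bijective (SmashOp.Lambda ρA) ∧ ρA.NormalBasis) : ρA.IsCleft :=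
    EntwinedModule.isCleft_of_lambda_bijective ρA h.1 h.2
  refine ⟨?_, fun _ => ?_⟩
  · tfae_have 1 → 2 := h12
    tfae_have 2 → 3 := h23
    tfae_have 3 → 4 := h34
    tfae_have 4 → 1 := h41
    tfae_finish
  · tfae_have 1 → 2 := h12
    tfae_have 2 → 3 := h23
    tfae_have 3 → 4 := h34
    tfae_have 4 → 1 := h41
    tfae_have 1 → 5 := fun h => ⟨h.strongStructureTheorem, h.normalBasis⟩
    tfae_have 5 → 2 := fun h => ⟨h.1.1, h.2⟩
    tfae_finish
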